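/- For a real antisymmetric $n\times n$ matrix $\theta$ put $\lambda^{\mu\nu}=e^{2\pi i\theta_{\mu\nu}}$. Let $\mathcal A(S^{2n-1}_\theta)$ be the unital complex $*$-algebra generated by $z^\mu,\bar z^\mu=(z^\mu)^*$ $(\mu=1,\dots,n)$ with relations $z^\mu z^\nu=\lambda^{\mu\nu}z^\nu z^\mu$, $\bar z^\mu z^\nu=\lambda^{\nu\mu}z^\nu\bar z^\mu$, $\bar z^\mu\bar z^\nu=\lambda^{\mu\nu}\bar z^\nu\bar z^\mu$, $\sum_\mu z^\mu\bar z^\mu=1$. For $\theta\in\mathbb R$ and $\lambda=e^{2\pi i\theta}$, let $\mathcal A(S^4_\theta)$ be the unital $*$-algebra generated by $\alpha,\beta$ and a central $x=x^*$ with relations $\alpha\beta=\lambda\beta\alpha$, $\alpha\beta^*=\bar\lambda\beta^*\alpha$, $\alpha\alpha^*=\alpha^*\alpha$, $\beta\beta^*=\beta^*\beta$, $\alpha\alpha^*+\beta\beta^*+x^2=1$. Let $\theta'$ be a real antisymmetric $4\times4$ matrix, $\lambda'^{ij}=e^{2\pi i\theta'_{ij}}$, and for $w\in SU(2)$ consider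 the prescription $$\alpha_w:(z^1,z^2,z^3,z^4)\mapsto(z^1,z^2,z^3,z^4)\begin{pmatrix}w&0\\0&w\end{pmatrix}$$ on the generators of $\mathcal A(S^7_{\theta'})$. 1. The following are equivalent: (a) for every $w\in SU(2)$, $\alpha_w$ extends to a $*$-automorphism of $\mathcal A(S^7_{\theta'})$; (b) $w\mapsto\alpha_w$ extends to an injective group homomorphism from $SU(2)$ to the group of $*$-automorphisms of $\mathcal A(S^7_{\theta'})$; (c) $\lambda'^{12}=\lambda'^{34}=1$ and $\lambda'^{14}=\lambda'^{23}=\lambda'^{24}=\lambda'^{13}$. 2. In that case the $*$-subalgebra $\mathrm{Inv}_{SU(2)}(\mathcal A(S^7_{\theta'}))$ of elements fixed by all $\alpha_w$ is generated, as a unital $*$-algebra, by $$\alpha=2(z^1\bar z^3+z^2\bar z^4),\quad \beta=2(-z^1z^4+z^2z^3),\quad x=z^1\bar z^1+z^2\bar z^2-z^3\bar z^3-z^4\bar z^4 .$$ 3. Let $\theta\in\mathbb R$, $\lambda=e^{2\pi i\theta}$. The following are equivalent: (a) $SU(2)$ acts on $\mathcal A(S^7_{\theta'})$ by the $*$-automorphisms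 $\alpha_w$, and $\mathrm{Inv}_{SU(2)}(\mathcal A(S^7_{\theta'}))=\mathcal A(S^4_\theta)$, in the sense that sending the generators $\alpha,\beta,x$ of $\mathcal A(S^4_\theta)$ to the elements $\alpha,\beta,x$ above defines an injective $*$-homomorphism $\mathcal A(S^4_\theta)\to\mathcal A(S^7_{\theta'})$ with image $\mathrm{Inv}_{SU(2)}(\mathcal A(S^7_{\theta'}))$; (b) there is a square root $\mu$ of $\lambda$ such that $$(\lambda'^{ij})=\begin{pmatrix}1&1&\mu&\mu\\1&1&\mu&\mu\\\bar\mu&\bar\mu&1&1\\\bar\mu&\bar\mu&1&1\end{pmatrix};$$ (c) for some integer $k$, $\theta'$ is congruent modulo integer matrices to $$\frac{\theta+k}{2}\begin{pmatrix}0&0&1&1\\0&0&1&1\\-1&-1&0&0\\-1&-1&0&0\end{pmatrix}.$$ 4. In particular, 3(a) holds if $\theta'$ equals $\frac{\theta}{2}$ times this block matrix. -/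

import Mathlib

noncomputable section

namespace HopfTheta

/-! ### Free unital complex `*`-algebras

The generators carry an involution `star : X → X` telling which generator is the adjoint of
which.  The `*`-structure on the free algebra is the conjugate linear, order reversing extension. -/

/-- The free unital complex algebra on `X`, as a type that will carry its own `*`-structure. -/
def FreeStar (X : Type) : Type := FreeAlgebra ℂ X

namespace FreeStar

variable {X : Type}

instance : Ring (FreeStar X) := inferInstanceAs (Ring (FreeAlgebra ℂ X))
instance : Algebra ℂ (FreeStar X) := inferInstanceAs (Algebra ℂ (FreeAlgebra ℂ X))

/-- The generators of the free algebra. -/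
def of (x : X) : FreeStar X := FreeAlgebra.ι ℂ x

theorem induction {P : FreeStar X → Prop} (h_scalar : ∀ c : ℂ, P (algebraMap ℂ _ c))
    (h_of : ∀ x, P (of x)) (h_mul : ∀ a b, P a → P b → P (a * b))
    (h_add : ∀ a b, P a → P b → P (a + b)) (a : FreeStar X) : P a :=
  FreeAlgebra.induction ℂ X (motive := P) h_scalar h_of h_mul h_add a

/-- The opposite of the free algebra with conjugated scalars; auxiliary for the `*`-structure. -/
def ConjOp (X : Type) : Type := (FreeStar X)ᵐᵒᵖ

instance : Ring (ConjOp X) := inferInstanceAs (Ring (FreeStar X)ᵐᵒᵖ)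
instance : Algebra ℂ (ConjOp X) :=
  RingHom.toAlgebra' ((algebraMap ℂ (FreeStar X)ᵐᵒᵖ).comp (starRingEnd ℂ))
    (fun c x => Algebra.commutes (R := ℂ) (A := (FreeStar X)ᵐᵒᵖ) (starRingEnd ℂ c) x)

variable [InvolutiveStar X]

/-- The `*`-operation of the free algebra, as an algebra map into the conjugate opposite. -/
def starAux : FreeStar X →ₐ[ℂ] ConjOp X :=
  FreeAlgebra.lift ℂ (fun x : X => (MulOpposite.op (of (star x)) : (FreeStar X)ᵐᵒᵖ))

instance : Star (FreeStar X) where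
  star a := MulOpposite.unop (starAux a : (FreeStar X)ᵐᵒᵖ)

theorem star_of (x : X) : star (of x) = of (star x) :=
  congrArg MulOpposite.unop (FreeAlgebra.lift_ι_apply (R := ℂ) (A := ConjOp X)
    (fun x : X => (MulOpposite.op (of (star x)) : (FreeStar X)ᵐᵒᵖ)) x)

theorem star_scalar (c : ℂ) :
    star (algebraMap ℂ (FreeStar X) c) = algebraMap ℂ (FreeStar X) (star c) :=
  congrArg MulOpposite.unop ((starAux (X := X)).commutes c)

theorem star_mul_aux (a b : FreeStar X) : star (a * b) = star b * star a :=
  congrArg MulOpposite.unop (map_mul (starAux (X := X)) a b)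

theorem star_add_aux (a b : FreeStar X) : star (a + b) = star a + star b :=
  congrArg MulOpposite.unop (map_add (starAux (X := X)) a b)

instance : StarRing (FreeStar X) where
  star_involutive a := by
    induction a using FreeStar.induction with
    | h_scalar c => rw [star_scalar, star_scalar, star_star]
    | h_of x => rw [star_of, star_of, star_star]
    | h_mul a b ha hb => rw [star_mul_aux, star_mul_aux, ha, hb]
    | h_add a b ha hb => rw [star_add_aux, star_add_aux, ha, hb]
  star_mul := star_mul_aux
  star_add := star_add_aux

instance : StarModule ℂ (FreeStar X) where
  star_smul c a := by
    rw [Algebra.smul_def, star_mul, star_scalar, ← Algebra.commutes, ← Algebra.smul_def]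

end FreeStar

/-! ### Quotients of free `*`-algebras by `*`-invariant relations -/

/-- The unital `*`-algebra with generators `X` and relations `r`. -/
def Presented {X : Type} (r : FreeStar X → FreeStar X → Prop) : Type := RingQuot r

namespace Presented

variable {X : Type} (r : FreeStar X → FreeStar X → Prop)

instance : Ring (Presented r) := inferInstanceAs (Ring (RingQuot r))
instance : Algebra ℂ (Presented r) := inferInstanceAs (Algebra ℂ (RingQuot r))

/-- The quotient map. -/
def mk : FreeStar X →ₐ[ℂ] Presented r := RingQuot.mkAlgHom ℂ r

theorem mk_surjective : Function.Surjective (mk r) := RingQuot.mkAlgHom_surjective ℂ r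

theorem mk_rel {a b : FreeStar X} (h : r a b) : mk r a = mk r b := RingQuot.mkAlgHom_rel ℂ h

variable [InvolutiveStar X]

/-- The `*`-structure on the quotient, induced by that of the free `*`-algebra. -/
@[reducible] def starRing (hr : ∀ a b, r a b → r (star a) (star b)) : StarRing (Presented r) :=
  RingQuot.starRing r hr

theorem star_mk (hr : ∀ a b, r a b → r (star a) (star b)) (a : FreeStar X) :
    (starRing r hr).star (mk r a) = mk r (star a) := by
  have h : ∀ b : FreeStar X, mk r b = (⟨Quot.mk _ b⟩ : RingQuot r) := fun b => by
    change RingQuot.mkAlgHom ℂ r b = _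
    simp only [RingQuot.mkAlgHom_def, RingQuot.mkRingHom_def]
    rfl
  rw [h, h]
  rfl

theorem starModule (hr : ∀ a b, r a b → r (star a) (star b)) :
    let _ := starRing r hr
    StarModule ℂ (Presented r) := by
  let _ := starRing r hr
  refine ⟨fun c a => ?_⟩
  obtain ⟨a, rfl⟩ := mk_surjective r a
  have h : ∀ b : FreeStar X, star (mk r b) = mk r (star b) := star_mk r hr
  rw [← map_smul, h, h, star_smul, map_smul]

end Presented

/-! ### The noncommutative spheres -/

/-- Antisymmetric real `n × n` matrices. -/
def Skew (n : ℕ) : Type := {θ : Matrix (Fin n) (Fin n) ℝ // θ.transpose = -θ}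

/-- `phase t = exp (2 π i t)`. -/
def phase (t : ℝ) : ℂ := Complex.exp (2 * Real.pi * Complex.I * t)

theorem star_phase (t : ℝ) : star (phase t) = phase (-t) := by
  simp only [phase, Complex.star_def, ← Complex.exp_conj]
  congr 1
  simp [Complex.conj_ofNat]

/-- The deformation parameters `λ^{μν} = exp (2 π i θ_{μν})`. -/
def Skew.lam {n : ℕ} (θ : Skew n) (i j : Fin n) : ℂ := phase (θ.1 i j)

theorem Skew.star_lam {n : ℕ} (θ : Skew n) (i j : Fin n) : star (θ.lam i j) = θ.lam j i := by
  have h : θ.1 j i = -θ.1 i j := congrFun (congrFun θ.2 i) j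
  rw [Skew.lam, Skew.lam, star_phase, h]

/-- Generators `z^μ`, `z̄^μ` of the polynomial functions on the `2n`-plane. -/
inductive OddGen (n : ℕ) : Type
  | z (i : Fin n)
  | zbar (i : Fin n)

instance (n : ℕ) : InvolutiveStar (OddGen n) where
  star | .z i => .zbar i
       | .zbar i => .z i
  star_involutive g := by cases g <;> rfl

/-- Generators `z^μ`, `z̄^μ`, `x` of the polynomial functions on the `(2n+1)`-plane. -/
inductive EvenGen (n : ℕ) : Type
  | z (i : Fin n)
  | zbar (i : Fin n)
  | x

instance (n : ℕ) : InvolutiveStar (EvenGen n) where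
  star | .z i => .zbar i
       | .zbar i => .z i
       | .x => .x
  star_involutive g := by cases g <;> rfl

open FreeStar in
/-- The relations of the polynomial `*`-algebra of the sphere `S_θ^{2n-1}`. -/
inductive OddRel {n : ℕ} (θ : Skew n) : FreeStar (OddGen n) → FreeStar (OddGen n) → Prop
  | zz (i j : Fin n) :
      OddRel θ (of (.z i) * of (.z j)) (θ.lam i j • (of (.z j) * of (.z i)))
  | zbarz (i j : Fin n) :
      OddRel θ (of (.zbar i) * of (.z j)) (θ.lam j i • (of (.z j) * of (.zbar i)))
  | zbarzbar (i j : Fin n) :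
      OddRel θ (of (.zbar i) * of (.zbar j)) (θ.lam i j • (of (.zbar j) * of (.zbar i)))
  | sphere : OddRel θ (∑ i, of (.z i) * of (.zbar i)) 1

open FreeStar in
/-- The relations of the polynomial `*`-algebra of the sphere `S_θ^{2n}`. -/
inductive EvenRel {n : ℕ} (θ : Skew n) : FreeStar (EvenGen n) → FreeStar (EvenGen n) → Prop
  | zz (i j : Fin n) :
      EvenRel θ (of (.z i) * of (.z j)) (θ.lam i j • (of (.z j) * of (.z i)))
  | zbarz (i j : Fin n) :
      EvenRel θ (of (.zbar i) * of (.z j)) (θ.lam j i • (of (.z j) * of (.zbar i)))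
  | zbarzbar (i j : Fin n) :
      EvenRel θ (of (.zbar i) * of (.zbar j)) (θ.lam i j • (of (.zbar j) * of (.zbar i)))
  | xz (i : Fin n) : EvenRel θ (of .x * of (.z i)) (of (.z i) * of .x)
  | zbarx (i : Fin n) : EvenRel θ (of (.zbar i) * of .x) (of .x * of (.zbar i))
  | sphere : EvenRel θ ((∑ i, of (.z i) * of (.zbar i)) + of .x * of .x) 1

theorem OddRel.star {n : ℕ} (θ : Skew n) (a b : FreeStar (OddGen n)) (h : OddRel θ a b) :
    OddRel θ (star a) (star b) := by
  cases h with
  | zz i j =>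
    simp only [star_smul, star_mul, FreeStar.star_of, Skew.star_lam]
    exact OddRel.zbarzbar j i
  | zbarz i j =>
    simp only [star_smul, star_mul, FreeStar.star_of, Skew.star_lam]
    exact OddRel.zbarz j i
  | zbarzbar i j =>
    simp only [star_smul, star_mul, FreeStar.star_of, Skew.star_lam]
    exact OddRel.zz j i
  | sphere =>
    simp only [star_sum, star_mul, FreeStar.star_of, star_one]
    exact OddRel.sphere

theorem EvenRel.star {n : ℕ} (θ : Skew n) (a b : FreeStar (EvenGen n)) (h : EvenRel θ a b) :
    EvenRel θ (star a) (star b) := by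
  cases h with
  | zz i j =>
    simp only [star_smul, star_mul, FreeStar.star_of, Skew.star_lam]
    exact EvenRel.zbarzbar j i
  | zbarz i j =>
    simp only [star_smul, star_mul, FreeStar.star_of, Skew.star_lam]
    exact EvenRel.zbarz j i
  | zbarzbar i j =>
    simp only [star_smul, star_mul, FreeStar.star_of, Skew.star_lam]
    exact EvenRel.zz j i
  | xz i =>
    simp only [star_mul, FreeStar.star_of]
    exact EvenRel.zbarx i
  | zbarx i =>
    simp only [star_mul, FreeStar.star_of]
    exact EvenRel.xz i
  | sphere =>
    simp only [star_add, star_sum, star_mul, FreeStar.star_of, star_one]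
    exact EvenRel.sphere

/-- The `*`-algebra `A(S_θ^{2n-1})` of polynomial functions on the sphere `S_θ^{2n-1}`. -/
abbrev OddSphere {n : ℕ} (θ : Skew n) : Type := Presented (OddRel θ)

/-- The `*`-algebra `A(S_θ^{2n})` of polynomial functions on the sphere `S_θ^{2n}`. -/
abbrev EvenSphere {n : ℕ} (θ : Skew n) : Type := Presented (EvenRel θ)

section instances

variable {n : ℕ} (θ : Skew n)

instance : StarRing (OddSphere θ) := Presented.starRing (OddRel θ) (OddRel.star θ)
instance : StarModule ℂ (OddSphere θ) := Presented.starModule (OddRel θ) (OddRel.star θ)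

instance : StarRing (EvenSphere θ) := Presented.starRing (EvenRel θ) (EvenRel.star θ)
instance : StarModule ℂ (EvenSphere θ) := Presented.starModule (EvenRel θ) (EvenRel.star θ)

/-- The generator `z^μ` of `A(S_θ^{2n-1})`; its adjoint `star (z θ μ)` is `z̄^μ`. -/
def z (i : Fin n) : OddSphere θ := Presented.mk (OddRel θ) (FreeStar.of (.z i))

/-- The generator `z^μ` of `A(S_θ^{2n})`. -/
def evenZ (i : Fin n) : EvenSphere θ := Presented.mk (EvenRel θ) (FreeStar.of (.z i))

/-- The central self-adjoint generator `x` of `A(S_θ^{2n})`. -/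
def evenX : EvenSphere θ := Presented.mk (EvenRel θ) (FreeStar.of .x)

theorem star_z (i : Fin n) :
    star (z θ i) = Presented.mk (OddRel θ) (FreeStar.of (.zbar i)) :=
  (Presented.star_mk (OddRel θ) (OddRel.star θ) _).trans
    (congrArg _ (FreeStar.star_of _))

theorem star_evenZ (i : Fin n) :
    star (evenZ θ i) = Presented.mk (EvenRel θ) (FreeStar.of (.zbar i)) :=
  (Presented.star_mk (EvenRel θ) (EvenRel.star θ) _).trans
    (congrArg _ (FreeStar.star_of _))

theorem star_evenX : star (evenX θ) = evenX θ :=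
  (Presented.star_mk (EvenRel θ) (EvenRel.star θ) _).trans
    (congrArg _ (FreeStar.star_of _))

end instances

/-- The antisymmetric `2 × 2` matrix given by the real number `θ`. -/
def skew2 (θ : ℝ) : Skew 2 := ⟨!![0, θ; -θ, 0], by
  ext i j; fin_cases i <;> fin_cases j <;> simp⟩

/-- `A(S_θ^4)` for a real number `θ`: its generators are `α = evenZ _ 0`, `β = evenZ _ 1` and the
central `x = evenX _`. -/
abbrev FourSphere (θ : ℝ) : Type := EvenSphere (skew2 θ)

/-! ### The action of `SU(2)` on the noncommutative seven-sphere -/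

/-- The classical group `SU(2)`. -/
abbrev SU2 : Type := Matrix.specialUnitaryGroup (Fin 2) ℂ

/-- The `4 × 4` block diagonal matrix with both diagonal blocks equal to `w`. -/
def doubled (w : Matrix (Fin 2) (Fin 2) ℂ) : Matrix (Fin 4) (Fin 4) ℂ :=
  !![w 0 0, w 0 1, 0, 0;
     w 1 0, w 1 1, 0, 0;
     0, 0, w 0 0, w 0 1;
     0, 0, w 1 0, w 1 1]

variable {θ' : Skew 4}

/-- The `*`-automorphism `f` acts on the generators as
`(z^1, z^2, z^3, z^4) ↦ (z^1, z^2, z^3, z^4) diag(w, w)`. -/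
def ActsAs (w : SU2) (f : OddSphere θ' ≃⋆ₐ[ℂ] OddSphere θ') : Prop :=
  ∀ j : Fin 4, f (z θ' j) = ∑ i : Fin 4, doubled w.1 i j • z θ' i

/-- The group homomorphism `a` from `SU(2)` to the `*`-automorphisms of `A(S_{θ'}^7)` is the action
`w ↦ α_w`. -/
def IsHopfAction (a : SU2 →* (OddSphere θ' ≃⋆ₐ[ℂ] OddSphere θ')) : Prop :=
  ∀ w : SU2, ActsAs w (a w)

/-- The `*`-subalgebra of `SU(2)`-invariant elements. -/
def Inv (a : SU2 →* (OddSphere θ' ≃⋆ₐ[ℂ] OddSphere θ')) : StarSubalgebra ℂ (OddSphere θ') where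
  carrier := {p | ∀ w, a w p = p}
  mul_mem' hp hq w := by rw [map_mul, hp w, hq w]
  add_mem' hp hq w := by rw [map_add, hp w, hq w]
  algebraMap_mem' c w := by
    rw [Algebra.algebraMap_eq_smul_one, map_smul, map_one]
  star_mem' hp w := by rw [map_star, hp w]

/-- `α = 2 (z^1 z̄^3 + z^2 z̄^4)`. -/
def hopfα (θ' : Skew 4) : OddSphere θ' :=
  (2 : ℂ) • (z θ' 0 * star (z θ' 2) + z θ' 1 * star (z θ' 3))

/-- `β = 2 (- z^1 z^4 + z^2 z^3)`. -/
def hopfβ (θ' : Skew 4) : OddSphere θ' :=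
  (2 : ℂ) • (-(z θ' 0 * z θ' 3) + z θ' 1 * z θ' 2)

/-- `x = z^1 z̄^1 + z^2 z̄^2 - z^3 z̄^3 - z^4 z̄^4`. -/
def hopfx (θ' : Skew 4) : OddSphere θ' :=
  z θ' 0 * star (z θ' 0) + z θ' 1 * star (z θ' 1)
    - z θ' 2 * star (z θ' 2) - z θ' 3 * star (z θ' 3)

/-- The invariant subalgebra is `A(S_θ^4)`: there is an injective unital `*`-homomorphism from
`A(S_θ^4)` to `A(S_{θ'}^7)` with image the invariant subalgebra, which sends the generators
`α`, `β`, `x` of `A(S_θ^4)` to the elements `α`, `β`, `x` of `A(S_{θ'}^7)`. -/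
def InvIsFourSphere (θ : ℝ) (a : SU2 →* (OddSphere θ' ≃⋆ₐ[ℂ] OddSphere θ')) : Prop :=
  ∃ φ : FourSphere θ →⋆ₐ[ℂ] OddSphere θ',
    φ (evenZ _ 0) = hopfα θ' ∧ φ (evenZ _ 1) = hopfβ θ' ∧ φ (evenX _) = hopfx θ' ∧
      Function.Injective φ ∧ φ.range = Inv a

/-- The matrix of deformation parameters with off-diagonal blocks `μ` and `μ̄`. -/
def lamMatrix (μ : ℂ) : Matrix (Fin 4) (Fin 4) ℂ :=
  !![1, 1, μ, μ;
     1, 1, μ, μ;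
     star μ, star μ, 1, 1;
     star μ, star μ, 1, 1]

/-- The antisymmetric matrix `(θ / 2) [[0, 0, 1, 1], [0, 0, 1, 1], [-1, -1, 0, 0], [-1, -1, 0, 0]]`. -/
def hopfSkew (θ : ℝ) : Skew 4 :=
  ⟨(θ / 2) • !![0, 0, 1, 1; 0, 0, 1, 1; -1, -1, 0, 0; -1, -1, 0, 0], by
    ext i j; fin_cases i <;> fin_cases j <;> simp⟩

end HopfTheta

end

/-!
The algebras of the noncommutative spheres are twists of the commutative coordinate rings of the
classical spheres, and all statements are reduced to the classical ones by means of
representations by Weyl operators.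

Let `G` be a real vector space with an alternating form `B` and let `U g` be the Weyl operator
`f ↦ (m ↦ phase (B m g) * f (m + g))` on functions on `G`. If degrees `d i` in `G` are chosen with
`phase (2 * B (d i) (d j)) = θ.lam i j`, then each point `p` of the classical sphere gives a
representation of `A(S_θ^{2n-1})`, in which `z i` acts as `p i • U (d i)` (`weylRep`). The symbol
of an element `a` is the function of `p` obtained by applying the image of `a` to the constant
function `1` and evaluating at `0`. An element with zero symbol is zero
(`IsTwisted.eq_zero_of_symbol`). Indeed the multiplications by the generators become commuting
operators when they are composed with suitable torus automorphisms, so that the algebra is a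
linear quotient of a polynomial ring on which the symbol is the evaluation of polynomials
(`IsTwisted.exists_quantization`); and a polynomial that vanishes on the sphere lies in the ideal
of the sphere, which the quotient map kills (`mem_span_of_eval_sphere`).

Existence of the action. Applying the relation between the images of two generators in
representations at points with one or two nonzero coordinates gives the conditions on the
parameters (`blockParam_of_actsAs`). Conversely, these say that the parameters are induced by a
grading in which `z 0`, `z 1` have the same degree and `z 2`, `z 3` have the same degree. The
substitution given by a matrix of `SU(2)` preserves degrees, hence the relations.

Invariants. With this grading the symbol of an invariant element is an invariant polynomial
function `F` on the classical sphere. Where `A = |p 0| ^ 2 + |p 1| ^ 2` is nonzero, some matrix of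
`SU(2)` moves `(p 0, p 1)` to `(√A, 0)`; this expresses `F` by `√A` and the coordinates `α`, `β`
of the Hopf map, and comparison of both signs of `√A` shows that `A ^ k * F` is a polynomial in
the Hopf coordinates for some `k`. The same holds for `B = |p 2| ^ 2 + |p 3| ^ 2`. Since
`A + B = 1`, powers of `A` and `B` are coprime, and `F` itself is a polynomial in the Hopf
coordinates (`mem_hopfFunctions_of_invariant`). Symbols of homogeneous elements multiply up to
phases, so `F` is the symbol of an element generated by `α`, `β` and `x`, which is the given
invariant element by faithfulness (`inv_eq_adjoin`).

The four-sphere. In the representations `α` and `β` act as multiples of Weyl operators that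
commute up to the square of `θ'.lam 0 2`; this gives the relation between the parameters, and
conversely the relations of the four-sphere. The homomorphism from the four-sphere is injective
because the criterion of vanishing symbols applies to the four-sphere as well, and the classical
Hopf map is onto (`exists_hopfMap_eq`).
-/

namespace HopfTheta

section untwisting

open MvPolynomial

/-! ### Weyl operators -/

theorem phase_add (s t : ℝ) : phase (s + t) = phase s * phase t := by
  simp only [phase, ← Complex.exp_add]
  congr 1
  push_cast
  ring

@[simp] theorem phase_zero : phase 0 = 1 := by simp [phase]

theorem phase_ne_zero (t : ℝ) : phase t ≠ 0 := Complex.exp_ne_zero _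

theorem phase_neg_mul_phase (t : ℝ) : phase (-t) * phase t = 1 := by
  rw [← phase_add, neg_add_cancel, phase_zero]

variable {G : Type} [AddCommGroup G] [Module ℝ G] (B : G →ₗ[ℝ] G →ₗ[ℝ] ℝ)

/-- The Weyl operator `f ↦ (m ↦ phase (B m g) * f (m + g))` on functions on `G`. -/
noncomputable def weyl (g : G) : Module.End ℂ (G → ℂ) where
  toFun f m := phase (B m g) * f (m + g)
  map_add' f f' := by ext m; simp [mul_add]
  map_smul' c f := by ext m; simp [mul_left_comm]

theorem weyl_apply (g : G) (f : G → ℂ) (m : G) :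
    weyl B g f m = phase (B m g) * f (m + g) := rfl

theorem weyl_zero : weyl B (0 : G) = 1 := by
  ext f m
  simp [weyl_apply]

theorem weyl_mul (g h : G) : weyl B g * weyl B h = phase (B g h) • weyl B (g + h) := by
  refine LinearMap.ext fun f => funext fun m => ?_
  simp only [Module.End.mul_apply, weyl_apply, LinearMap.smul_apply, Pi.smul_apply, smul_eq_mul,
    map_add, LinearMap.add_apply, phase_add, add_assoc]
  ring

theorem weyl_mul_comm (hB : B.IsAlt) (g h : G) :
    weyl B g * weyl B h = phase (2 * B g h) • (weyl B h * weyl B g) := by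
  rw [weyl_mul, weyl_mul, smul_smul, ← phase_add, add_comm h g, ← hB.neg g h]
  congr 2
  ring

theorem weyl_mul_neg (hB : B.IsAlt) (g : G) : weyl B g * weyl B (-g) = 1 := by
  rw [weyl_mul, map_neg, hB g, neg_zero, phase_zero, one_smul, add_neg_cancel, weyl_zero]

theorem weyl_one_zero (g : G) : weyl B g 1 0 = 1 := by simp [weyl_apply]

theorem weyl_ne_zero (g : G) : weyl B g ≠ 0 := fun h => by
  simpa [h] using weyl_one_zero B g

/-! ### Untwisting -/

/-- The generators `t i` of the algebra `A` have degrees `d i`, commute up to the phases that the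
alternating form `B` assigns to their degrees, and can be rescaled by the torus of characters of
the grading. -/
structure IsTwisted {A ι : Type} [Ring A] [Algebra ℂ A] (t : ι → A) (d : ι → G) : Prop where
  comm : ∀ i j, t i * t j = phase (2 * B (d i) (d j)) • (t j * t i)
  adjoin_eq_top : Algebra.adjoin ℂ (Set.range t) = ⊤
  exists_torus : ∀ g, ∃ τ : A →ₐ[ℂ] A, ∀ i, τ (t i) = phase (-B g (d i)) • t i

theorem exists_algHom_of_commute {ι E : Type} [Ring E] [Algebra ℂ E] (L : ι → E)
    (h : ∀ i j, L i * L j = L j * L i) :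
    ∃ Q : MvPolynomial ι ℂ →ₐ[ℂ] E, ∀ i, Q (X i) = L i := by
  have hc : ∀ a ∈ Set.range L, ∀ b ∈ Set.range L, a * b = b * a := by
    rintro _ ⟨i, rfl⟩ _ ⟨j, rfl⟩
    exact h i j
  have := Algebra.isMulCommutative_adjoin ℂ hc
  let _ : CommRing (Algebra.adjoin ℂ (Set.range L)) :=
    { (inferInstance : Ring (Algebra.adjoin ℂ (Set.range L))) with
      mul_comm := fun a b => this.is_comm.comm a b }
  let L' : ι → Algebra.adjoin ℂ (Set.range L) :=
    fun i => ⟨L i, Algebra.subset_adjoin (Set.mem_range_self i)⟩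
  exact ⟨(Algebra.adjoin ℂ (Set.range L)).val.comp (aeval L'), fun i => by simp [L']⟩

variable {B} {A ι : Type} [Ring A] [Algebra ℂ A] {t : ι → A} {d : ι → G}

/-- The torus automorphism `τ` corresponds to a translation in the Weyl representation. -/
theorem IsTwisted.apply_torus_add (ht : IsTwisted B t d) {ρ : A →ₐ[ℂ] Module.End ℂ (G → ℂ)}
    {c : ι → ℂ} (hρ : ∀ i, ρ (t i) = c i • weyl B (d i)) {g : G} {τ : A →ₐ[ℂ] A}
    (hτ : ∀ i, τ (t i) = phase (-B g (d i)) • t i) (a : A) (f : G → ℂ) (m : G) :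
    ρ (τ a) f (m + g) = ρ a (fun k => f (k + g)) m := by
  have ha : a ∈ Algebra.adjoin ℂ (Set.range t) := ht.adjoin_eq_top ▸ trivial
  induction ha using Algebra.adjoin_induction generalizing f m with
  | mem x hx =>
    obtain ⟨i, rfl⟩ := hx
    simp only [hτ, map_smul, hρ, LinearMap.smul_apply, Pi.smul_apply, weyl_apply, smul_eq_mul,
      map_add, LinearMap.add_apply, phase_add]
    rw [show m + g + d i = m + d i + g by abel]
    linear_combination c i * phase (B m (d i)) * f (m + d i + g) *
      phase_neg_mul_phase (B g (d i))
  | algebraMap r => simp [Algebra.algebraMap_eq_smul_one]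
  | add x y _ _ hx hy => simp [hx, hy]
  | mul x y _ _ hx hy =>
    simp only [map_mul, Module.End.mul_apply, hx]
    exact congrArg (fun F => ρ x F m) (_root_.funext fun k => hy f k)

/-- Untwisting: the algebra `A` is a linear quotient of the polynomial ring in its generators, in
such a way that the Weyl representations become evaluations of polynomials. The variable `X i` acts
on `A` as the multiplication by `t i` after the torus automorphism of parameter `d i`; these
operators commute. -/
theorem IsTwisted.exists_quantization (ht : IsTwisted B t d) (hB : B.IsAlt) :
    ∃ Q : MvPolynomial ι ℂ →ₗ[ℂ] A, Function.Surjective Q ∧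
      (∀ i j, d i + d j = 0 → ∀ f, Q (X i * X j * f) = t i * t j * Q f) ∧
      ∀ (ρ : A →ₐ[ℂ] Module.End ℂ (G → ℂ)) (c : ι → ℂ), (∀ i, ρ (t i) = c i • weyl B (d i)) →
        ∀ f, ρ (Q f) 1 0 = eval c f := by
  choose τ hτ using ht.exists_torus
  have hττ (g h : G) : (τ g).comp (τ h) = τ (g + h) := by
    refine AlgHom.ext_of_adjoin_eq_top ht.adjoin_eq_top ?_
    rintro _ ⟨i, rfl⟩
    simp only [AlgHom.comp_apply, hτ, map_smul, smul_smul, ← phase_add, map_add,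
      LinearMap.add_apply]
    congr 2
    ring
  have hττ' (g h : G) (a : A) : τ g (τ h a) = τ (g + h) a := DFunLike.congr_fun (hττ g h) a
  have hτ0 : τ 0 = AlgHom.id ℂ A := by
    refine AlgHom.ext_of_adjoin_eq_top ht.adjoin_eq_top ?_
    rintro _ ⟨i, rfl⟩
    simp [hτ]
  let L (i : ι) : Module.End ℂ A := LinearMap.mulLeft ℂ (t i) ∘ₗ (τ (d i)).toLinearMap
  have hL (i : ι) (a : A) : L i a = t i * τ (d i) a := rfl
  have hLL (i j : ι) : L i * L j = L j * L i := by
    refine LinearMap.ext fun a => ?_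
    simp only [Module.End.mul_apply, hL, map_mul, hτ, hττ', add_comm (d j) (d i)]
    rw [smul_mul_assoc, smul_mul_assoc, mul_smul_comm, mul_smul_comm, ← mul_assoc, ← mul_assoc,
      ht.comm i j, smul_mul_assoc, smul_smul, ← phase_add, ← hB.neg (d i) (d j)]
    congr 2
    ring
  obtain ⟨Q, hQ⟩ := exists_algHom_of_commute L hLL
  have hX (i : ι) (f : MvPolynomial ι ℂ) : Q (X i * f) 1 = t i * τ (d i) (Q f 1) := by
    rw [map_mul, hQ, Module.End.mul_apply, hL]
  refine ⟨LinearMap.applyₗ 1 ∘ₗ Q.toLinearMap, ?_, ?_, ?_⟩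
  · -- the image is stable under the torus, hence under left multiplication by the generators
    have htor (g : G) (f : MvPolynomial ι ℂ) : ∃ f', τ g (Q f 1) = Q f' 1 := by
      induction f using MvPolynomial.induction_on with
      | C r =>
        refine ⟨C r, ?_⟩
        rw [← algebraMap_eq, AlgHom.commutes]
        simp [Algebra.algebraMap_eq_smul_one]
      | add f f' hf hf' =>
        obtain ⟨k, hk⟩ := hf
        obtain ⟨k', hk'⟩ := hf'
        exact ⟨k + k', by simp [hk, hk']⟩
      | mul_X f i hf =>
        obtain ⟨k, hk⟩ := hf
        refine ⟨phase (-B g (d i)) • (X i * k), ?_⟩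
        rw [mul_comm f, hX, map_mul, hτ, hττ', add_comm, ← hττ', hk, map_smul,
          LinearMap.smul_apply, hX, smul_mul_assoc]
    have hmul (a : A) (f : MvPolynomial ι ℂ) : ∃ f', a * Q f 1 = Q f' 1 := by
      have ha : a ∈ Algebra.adjoin ℂ (Set.range t) := ht.adjoin_eq_top ▸ trivial
      induction ha using Algebra.adjoin_induction generalizing f with
      | mem x hx =>
        obtain ⟨i, rfl⟩ := hx
        obtain ⟨k, hk⟩ := htor (-d i) f
        exact ⟨X i * k, by rw [hX, ← hk, hττ', add_neg_cancel, hτ0, AlgHom.id_apply]⟩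
      | algebraMap r => exact ⟨r • f, by rw [map_smul, LinearMap.smul_apply, Algebra.smul_def]⟩
      | add x y _ _ hx hy =>
        obtain ⟨k, hk⟩ := hx f
        obtain ⟨k', hk'⟩ := hy f
        exact ⟨k + k', by simp [add_mul, hk, hk']⟩
      | mul x y _ _ hx hy =>
        obtain ⟨k, hk⟩ := hy f
        obtain ⟨k', hk'⟩ := hx k
        exact ⟨k', by rw [mul_assoc, hk, hk']⟩
    intro a
    obtain ⟨f, hf⟩ := hmul a 1
    exact ⟨f, by simpa using hf.symm⟩
  · intro i j hij f
    change Q (X i * X j * f) 1 = t i * t j * Q f 1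
    have hj : d j = -d i := (neg_eq_of_add_eq_zero_right hij).symm
    rw [mul_assoc, hX, hX, map_mul, hττ', hij, hτ0, hτ, hj, map_neg, hB (d i)]
    simp [mul_assoc]
  · intro ρ c hρ f
    change ρ (Q f 1) 1 0 = eval c f
    induction f using MvPolynomial.induction_on with
    | C r =>
      rw [← algebraMap_eq, AlgHom.commutes]
      simp [Algebra.algebraMap_eq_smul_one]
    | add f f' hf hf' => simp [hf, hf']
    | mul_X f i hf =>
      have h := ht.apply_torus_add hρ (hτ (d i)) (Q f 1) 1 0
      rw [mul_comm f, hX, map_mul, hρ, Module.End.mul_apply, LinearMap.smul_apply, Pi.smul_apply,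
        weyl_apply, h, map_zero, LinearMap.zero_apply, phase_zero, one_mul, smul_eq_mul,
        eval_mul, eval_X, ← hf]
      rfl

/-! ### Polynomials on spheres -/

/-- Modulo `q - 1`, every polynomial is the sum of an "even" polynomial `E` and an "odd" polynomial
`O`: both are homogenized by powers of `q`, which stands for the square of a radius `r`. -/
theorem exists_parity_homogenization {ι : Type} (q f : MvPolynomial ι ℂ) :
    ∃ (M : ℕ) (E O : MvPolynomial ι ℂ), f - (E + O) ∈ Ideal.span {q - 1} ∧
      ∀ (c : ι → ℂ) (r : ℂ), r ≠ 0 → eval c q = r ^ 2 →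
        r ^ (2 * M) * eval (r⁻¹ • c) f = eval c E + r * eval c O := by
  have hq : q - 1 ∈ Ideal.span {q - 1} := Ideal.subset_span rfl
  have hpow (n : ℕ) : 1 - q ^ n ∈ Ideal.span {q - 1} := by
    rw [Ideal.mem_span_singleton, ← neg_dvd, neg_sub]
    simpa using sub_dvd_pow_sub_pow (1 : MvPolynomial ι ℂ) q n
  induction f using MvPolynomial.induction_on with
  | C a => exact ⟨0, C a, 0, by simp, by simp⟩
  | add f f' hf hf' =>
    obtain ⟨M, E, O, h1, h2⟩ := hf
    obtain ⟨M', E', O', h1', h2'⟩ := hf'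
    refine ⟨M + M', q ^ M' * E + q ^ M * E', q ^ M' * O + q ^ M * O', ?_, ?_⟩
    · have := add_mem (add_mem h1 h1') (add_mem (Ideal.mul_mem_right (E + O) _ (hpow M'))
        (Ideal.mul_mem_right (E' + O') _ (hpow M)))
      convert! this using 1
      ring
    · intro c r hr hc
      simp only [map_add, map_mul, map_pow, hc]
      linear_combination r ^ (2 * M') * h2 c r hr hc + r ^ (2 * M) * h2' c r hr hc
  | mul_X f i hf =>
    obtain ⟨M, E, O, h1, h2⟩ := hf
    refine ⟨M + 1, q * X i * O, X i * E, ?_, ?_⟩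
    · have := sub_mem (Ideal.mul_mem_left _ (X i) h1) (Ideal.mul_mem_left _ (X i * O) hq)
      convert! this using 1
      ring
    · intro c r hr hc
      simp only [map_mul, eval_X, hc, Pi.smul_apply, smul_eq_mul]
      have : r ^ (2 * (M + 1)) * (r⁻¹ * c i) = r ^ (2 * M) * (r * c i) := by
        field_simp
        ring
      linear_combination r * c i * h2 c r hr hc + eval (r⁻¹ • c) f * this

/-- A polynomial in the generators that vanishes wherever the involution of the generators acts by
complex conjugation is zero. -/
theorem eq_zero_of_eval_real_eq_zero {ι : Type} [InvolutiveStar ι] (f : MvPolynomial ι ℂ)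
    (hf : ∀ c : ι → ℂ, (∀ i, c (star i) = star (c i)) → eval c f = 0) : f = 0 := by
  let a : ℂ := (1 + Complex.I) / 2
  let b : ℂ := (1 - Complex.I) / 2
  have hab : a * a + b * b = 0 := by
    simp only [a, b]; linear_combination (1 / 2 : ℂ) * Complex.I_sq
  have hab' : a * b = 1 / 2 := by
    simp only [a, b]; linear_combination (-1 / 4 : ℂ) * Complex.I_sq
  have hsa : star a = b := by
    simp [a, b, sub_eq_add_neg]
  have hsb : star b = a := by rw [← hsa, star_star]
  let u : ι → MvPolynomial ι ℂ := fun i => C a * X i + C b * X (star i)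
  let v : ι → MvPolynomial ι ℂ := fun i => C b * X i + C a * X (star i)
  have h0 : aeval u f = 0 := by
    refine funext_set (fun _ => Set.range (Complex.ofReal))
      (fun _ => Set.infinite_range_of_injective Complex.ofReal_injective) fun x hx => ?_
    rw [map_zero]
    have hx' : ∀ i, star (x i) = x i := fun i => by
      obtain ⟨y, hy⟩ := hx i trivial
      rw [← hy]
      exact Complex.conj_ofReal y
    have := hf (fun i => a * x i + b * x (star i)) fun i => by
      simp only [star_star, star_add, star_mul', hsa, hsb, hx']
      ring
    rw [← this, ← coe_aeval_eq_eval, RingHom.coe_coe, comp_aeval_apply]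
    simp [u]
  have h1 : aeval v (aeval u f) = f := by
    rw [← AlgHom.comp_apply]
    conv_rhs => rw [← AlgHom.id_apply (R := ℂ) f]
    congr 1
    refine algHom_ext fun i => ?_
    simp only [AlgHom.comp_apply, aeval_X, AlgHom.id_apply, u, v, map_add, map_mul, algHom_C,
      algebraMap_eq, star_star]
    have hC : C a * C a + C b * C b = (0 : MvPolynomial ι ℂ) := by
      rw [← C_mul, ← C_mul, ← C_add, hab, C_0]
    have hC' : 2 * (C a * C b) = (1 : MvPolynomial ι ℂ) := by
      rw [← C_mul, hab', show (2 : MvPolynomial ι ℂ) = C 2 from (map_ofNat C 2).symm, ← C_mul]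
      norm_num
    linear_combination X i * hC' + X (star i) * hC
  rw [← h1, h0, map_zero]

/-- A polynomial that vanishes on the unit sphere of the hermitian form `∑ k, |c (u k)| ^ 2` lies in
the ideal of the sphere: its even and odd parts vanish separately on the lines through the origin,
so that they are zero modulo that ideal. -/
theorem mem_span_of_eval_sphere {ι κ : Type} [InvolutiveStar ι] [Fintype κ] (u : κ → ι)
    (f : MvPolynomial ι ℂ)
    (hf : ∀ c : ι → ℂ, (∀ i, c (star i) = star (c i)) → ∑ k, c (u k) * c (star (u k)) = 1 →
      eval c f = 0) :
    f ∈ Ideal.span {∑ k, X (u k) * X (star (u k)) - 1} := by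
  set q : MvPolynomial ι ℂ := ∑ k, X (u k) * X (star (u k)) with hq
  obtain ⟨M, E, O, h, hEO⟩ := exists_parity_homogenization q f
  have key (c : ι → ℂ) (hc : ∀ i, c (star i) = star (c i)) :
      eval c (q * E) = 0 ∧ eval c (q * O) = 0 := by
    obtain ⟨r, hr⟩ : ∃ r : ℝ, eval c q = (r : ℂ) ^ 2 := by
      refine ⟨√(∑ k, Complex.normSq (c (u k))), ?_⟩
      rw [← Complex.ofReal_pow, Real.sq_sqrt (Finset.sum_nonneg fun k _ => Complex.normSq_nonneg _)]
      simp [hq, hc, Complex.mul_conj]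
    by_cases hr0 : r = 0
    · simp [hr, hr0]
    have hr0' : (r : ℂ) ≠ 0 := by exact_mod_cast hr0
    -- `f` vanishes at both unit vectors on the line through `c`
    have hv (s : ℝ) (hs : (s : ℂ) ≠ 0) (hs' : eval c q = (s : ℂ) ^ 2) :
        eval ((s : ℂ)⁻¹ • c) f = 0 := by
      refine hf _ (fun i => by simp [hc]) ?_
      have : ∑ k, c (u k) * c (star (u k)) = (s : ℂ) ^ 2 := by rw [← hs']; simp [hq]
      have h' (k : κ) : ((s : ℂ)⁻¹ • c) (u k) * ((s : ℂ)⁻¹ • c) (star (u k)) =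
          ((s : ℂ) ^ 2)⁻¹ * (c (u k) * c (star (u k))) := by
        simp only [Pi.smul_apply, smul_eq_mul]
        ring
      rw [Finset.sum_congr rfl fun k _ => h' k, ← Finset.mul_sum, this,
        inv_mul_cancel₀ (pow_ne_zero 2 hs)]
    have h1 := hEO c r hr0' hr
    have h2 := hEO c (-r : ℝ) (by simpa using hr0) (by simpa using hr)
    rw [hv r hr0' hr] at h1
    rw [hv (-r) (by simpa using hr0) (by simpa using hr)] at h2
    push_cast at h2
    have hE : eval c E = 0 := by linear_combination (-1 / 2 : ℂ) * (h1 + h2)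
    have hO : (r : ℂ) * eval c O = 0 := by linear_combination (-1 / 2 : ℂ) * (h1 - h2)
    simp [hE, (mul_eq_zero.mp hO).resolve_left hr0']
  have hE := eq_zero_of_eval_real_eq_zero (q * E) fun c hc => (key c hc).1
  have hO := eq_zero_of_eval_real_eq_zero (q * O) fun c hc => (key c hc).2
  have := sub_mem h (Ideal.mul_mem_right (E + O) _ (Ideal.subset_span (Set.mem_singleton (q - 1))))
  convert! this using 1
  linear_combination hE + hO

/-- An element of a twisted algebra with a sphere relation vanishes as soon as its image in every
Weyl representation attached to a point `c` of the sphere sends the constant function `1` to a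
function vanishing at `0`. -/
theorem IsTwisted.eq_zero_of_symbol {κ : Type} [InvolutiveStar ι] [Fintype κ] {u : κ → ι}
    (ht : IsTwisted B t d) (hB : B.IsAlt) (hd : ∀ i, d (star i) = -d i)
    (hu : ∑ k, t (u k) * t (star (u k)) = 1) (a : A)
    (ha : ∀ c : ι → ℂ, (∀ i, c (star i) = star (c i)) → ∑ k, c (u k) * c (star (u k)) = 1 →
      ∃ ρ : A →ₐ[ℂ] Module.End ℂ (G → ℂ), (∀ i, ρ (t i) = c i • weyl B (d i)) ∧ ρ a 1 0 = 0) :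
    a = 0 := by
  obtain ⟨Q, hsurj, hmul, hev⟩ := ht.exists_quantization hB
  obtain ⟨f, rfl⟩ := hsurj a
  have hmem := mem_span_of_eval_sphere u f fun c hc hc1 => by
    obtain ⟨ρ, hρ, h0⟩ := ha c hc hc1
    rw [← hev ρ c hρ, h0]
  obtain ⟨g, rfl⟩ := Ideal.mem_span_singleton.mp hmem
  simp only [sub_mul, one_mul, Finset.sum_mul, map_sub, map_sum]
  rw [Finset.sum_congr rfl fun k _ => hmul (u k) (star (u k)) (by rw [hd, add_neg_cancel]) g,
    ← Finset.sum_mul, hu, one_mul, sub_self]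

end untwisting

/-! ### Homomorphisms out of the presented algebras -/

section lift

variable {X : Type} {R : Type} [Ring R] [Algebra ℂ R]

/-- The homomorphism out of the free algebra with prescribed values on the generators. -/
def FreeStar.lift (y : X → R) : FreeStar X →ₐ[ℂ] R := FreeAlgebra.lift ℂ y

@[simp] theorem FreeStar.lift_of (y : X → R) (x : X) : FreeStar.lift y (FreeStar.of x) = y x :=
  FreeAlgebra.lift_ι_apply y x

variable {r : FreeStar X → FreeStar X → Prop}

/-- The homomorphism out of a presented algebra with prescribed values on the generators. -/
def Presented.lift (y : X → R) (h : ∀ ⦃a b⦄, r a b → FreeStar.lift y a = FreeStar.lift y b) :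
    Presented r →ₐ[ℂ] R :=
  RingQuot.liftAlgHom ℂ ⟨FreeStar.lift y, h⟩

/-- The generators of a presented algebra. -/
def Presented.gen (r : FreeStar X → FreeStar X → Prop) (x : X) : Presented r :=
  Presented.mk r (FreeStar.of x)

theorem Presented.lift_gen (y : X → R)
    (h : ∀ ⦃a b⦄, r a b → FreeStar.lift y a = FreeStar.lift y b) (x : X) :
    Presented.lift y h (Presented.gen r x) = y x :=
  (RingQuot.liftAlgHom_mkAlgHom_apply ℂ (FreeStar.lift y) h _).trans (FreeStar.lift_of y x)

theorem Presented.adjoin_range_gen : Algebra.adjoin ℂ (Set.range (Presented.gen r)) = ⊤ := by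
  rw [eq_top_iff]
  rintro a -
  obtain ⟨a, rfl⟩ := Presented.mk_surjective r a
  induction a using FreeStar.induction with
  | h_scalar c => rw [AlgHom.commutes]; exact Subalgebra.algebraMap_mem _ c
  | h_of x => exact Algebra.subset_adjoin ⟨x, rfl⟩
  | h_mul a b ha hb => rw [map_mul]; exact mul_mem ha hb
  | h_add a b ha hb => rw [map_add]; exact add_mem ha hb

theorem Presented.hom_ext {f g : Presented r →ₐ[ℂ] R}
    (h : ∀ x, f (Presented.gen r x) = g (Presented.gen r x)) : f = g := by
  refine AlgHom.ext_of_adjoin_eq_top Presented.adjoin_range_gen ?_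
  rintro _ ⟨x, rfl⟩
  exact h x

end lift

theorem Skew.lam_mul_lam {n : ℕ} (θ : Skew n) (i j : Fin n) : θ.lam i j * θ.lam j i = 1 := by
  have h : θ.1 j i = -θ.1 i j := congrFun (congrFun θ.2 i) j
  rw [Skew.lam, Skew.lam, h, mul_comm, phase_neg_mul_phase]

theorem Skew.lam_self {n : ℕ} (θ : Skew n) (i : Fin n) : θ.lam i i = 1 := by
  have h : θ.1 i i = -θ.1 i i := congrFun (congrFun θ.2 i) i
  rw [Skew.lam, self_eq_neg.mp h, phase_zero]

section spheres

variable {G : Type} [AddCommGroup G] [Module ℝ G] {B : G →ₗ[ℝ] G →ₗ[ℝ] ℝ} {n : ℕ} {θ : Skew n}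
  {d : Fin n → G} {R : Type} [Ring R] [Algebra ℂ R]

/-- Degrees of the generators of an odd sphere. -/
def OddGen.deg (d : Fin n → G) : OddGen n → G
  | .z i => d i
  | .zbar i => -d i

/-- Degrees of the generators of an even sphere. -/
def EvenGen.deg (d : Fin n → G) : EvenGen n → G
  | .z i => d i
  | .zbar i => -d i
  | .x => 0

/-- Coordinates of a point of complex `n`-space. -/
def OddGen.val (p : Fin n → ℂ) : OddGen n → ℂ
  | .z i => p i
  | .zbar i => star (p i)

/-- The form `B` and the degrees `d` induce the deformation parameters of `θ`. -/
def Grades (B : G →ₗ[ℝ] G →ₗ[ℝ] ℝ) (d : Fin n → G) (θ : Skew n) : Prop :=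
  ∀ i j, phase (2 * B (d i) (d j)) = θ.lam i j

theorem Grades.phase_neg (hd : Grades B d θ) (i j : Fin n) :
    phase (-(2 * B (d i) (d j))) = θ.lam j i := by
  rw [← star_phase, hd, Skew.star_lam]

/-- An odd sphere is mapped to any algebra with elements that commute up to the phases given by the
degrees and satisfy the sphere relation. -/
def OddSphere.lift (hd : Grades B d θ) (y : OddGen n → R)
    (hy : ∀ a b, y a * y b = phase (2 * B (OddGen.deg d a) (OddGen.deg d b)) • (y b * y a))
    (hs : ∑ i, y (.z i) * y (.zbar i) = 1) : OddSphere θ →ₐ[ℂ] R :=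
  Presented.lift y (by
    rintro _ _ (⟨i, j⟩ | ⟨i, j⟩ | ⟨i, j⟩ | _)
    · simpa [hd i j, OddGen.deg] using hy (.z i) (.z j)
    · simpa [hd.phase_neg i j, OddGen.deg] using hy (.zbar i) (.z j)
    · simpa [hd i j, OddGen.deg] using hy (.zbar i) (.zbar j)
    · simpa using hs)

@[simp] theorem OddSphere.lift_gen (hd : Grades B d θ) (y : OddGen n → R)
    (hy : ∀ a b, y a * y b = phase (2 * B (OddGen.deg d a) (OddGen.deg d b)) • (y b * y a))
    (hs : ∑ i, y (.z i) * y (.zbar i) = 1) (a : OddGen n) :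
    OddSphere.lift hd y hy hs (Presented.gen _ a) = y a :=
  Presented.lift_gen _ _ a

/-- An even sphere is mapped to any algebra with elements that commute up to the phases given by
the degrees and satisfy the sphere relation. -/
def EvenSphere.lift (hd : Grades B d θ) (y : EvenGen n → R)
    (hy : ∀ a b, y a * y b = phase (2 * B (EvenGen.deg d a) (EvenGen.deg d b)) • (y b * y a))
    (hs : ∑ i, y (.z i) * y (.zbar i) + y .x * y .x = 1) : EvenSphere θ →ₐ[ℂ] R :=
  Presented.lift y (by
    rintro _ _ (⟨i, j⟩ | ⟨i, j⟩ | ⟨i, j⟩ | i | i | _)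
    · simpa [hd i j, EvenGen.deg] using hy (.z i) (.z j)
    · simpa [hd.phase_neg i j, EvenGen.deg] using hy (.zbar i) (.z j)
    · simpa [hd i j, EvenGen.deg] using hy (.zbar i) (.zbar j)
    · simpa [EvenGen.deg] using hy .x (.z i)
    · simpa [EvenGen.deg] using hy (.zbar i) .x
    · simpa using hs)

@[simp] theorem EvenSphere.lift_gen (hd : Grades B d θ) (y : EvenGen n → R)
    (hy : ∀ a b, y a * y b = phase (2 * B (EvenGen.deg d a) (EvenGen.deg d b)) • (y b * y a))
    (hs : ∑ i, y (.z i) * y (.zbar i) + y .x * y .x = 1) (a : EvenGen n) :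
    EvenSphere.lift hd y hy hs (Presented.gen _ a) = y a :=
  Presented.lift_gen _ _ a

theorem OddSphere.gen_mul_gen (hd : Grades B d θ) (a b : OddGen n) :
    Presented.gen (OddRel θ) a * Presented.gen (OddRel θ) b =
      phase (2 * B (OddGen.deg d a) (OddGen.deg d b)) •
        (Presented.gen (OddRel θ) b * Presented.gen (OddRel θ) a) := by
  have zbarz (i j : Fin n) := Presented.mk_rel _ (OddRel.zbarz (θ := θ) i j)
  rcases a with i | i <;> rcases b with j | j
  · simpa [hd i j, OddGen.deg, Presented.gen] using Presented.mk_rel _ (OddRel.zz (θ := θ) i j)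
  · have := zbarz j i
    simp only [map_mul, map_smul] at this
    simp only [OddGen.deg, map_neg, mul_neg, hd.phase_neg i j, Presented.gen]
    rw [this, smul_smul, Skew.lam_mul_lam, one_smul]
  · simpa [hd.phase_neg i j, OddGen.deg, Presented.gen] using zbarz i j
  · simpa [hd i j, OddGen.deg, Presented.gen] using
      Presented.mk_rel _ (OddRel.zbarzbar (θ := θ) i j)

theorem EvenSphere.gen_mul_gen (hd : Grades B d θ) (a b : EvenGen n) :
    Presented.gen (EvenRel θ) a * Presented.gen (EvenRel θ) b =
      phase (2 * B (EvenGen.deg d a) (EvenGen.deg d b)) •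
        (Presented.gen (EvenRel θ) b * Presented.gen (EvenRel θ) a) := by
  have zbarz (i j : Fin n) := Presented.mk_rel _ (EvenRel.zbarz (θ := θ) i j)
  rcases a with i | i | _ <;> rcases b with j | j | _
  · simpa [hd i j, EvenGen.deg, Presented.gen] using Presented.mk_rel _ (EvenRel.zz (θ := θ) i j)
  · have := zbarz j i
    simp only [map_mul, map_smul] at this
    simp only [EvenGen.deg, map_neg, mul_neg, hd.phase_neg i j, Presented.gen]
    rw [this, smul_smul, Skew.lam_mul_lam, one_smul]
  · simpa [EvenGen.deg, Presented.gen] using (Presented.mk_rel _ (EvenRel.xz (θ := θ) i)).symm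
  · simpa [hd.phase_neg i j, EvenGen.deg, Presented.gen] using zbarz i j
  · simpa [hd i j, EvenGen.deg, Presented.gen] using
      Presented.mk_rel _ (EvenRel.zbarzbar (θ := θ) i j)
  · simpa [EvenGen.deg, Presented.gen] using Presented.mk_rel _ (EvenRel.zbarx (θ := θ) i)
  · simpa [EvenGen.deg, Presented.gen] using Presented.mk_rel _ (EvenRel.xz (θ := θ) j)
  · simpa [EvenGen.deg, Presented.gen] using (Presented.mk_rel _ (EvenRel.zbarx (θ := θ) j)).symm
  · simp [EvenGen.deg]

theorem OddSphere.sum_gen (θ : Skew n) :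
    ∑ i, Presented.gen (OddRel θ) (.z i) * Presented.gen (OddRel θ) (.zbar i) = 1 := by
  simpa [Presented.gen] using Presented.mk_rel _ (OddRel.sphere (θ := θ))

theorem EvenSphere.sum_gen (θ : Skew n) :
    ∑ i, Presented.gen (EvenRel θ) (.z i) * Presented.gen (EvenRel θ) (.zbar i) +
      Presented.gen (EvenRel θ) .x * Presented.gen (EvenRel θ) .x = 1 := by
  simpa [Presented.gen] using Presented.mk_rel _ (EvenRel.sphere (θ := θ))

theorem smul_mul_smul_comm_of_phase {a b : R} {s : ℂ} (x y : ℂ) (h : a * b = s • (b * a)) :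
    (x • a) * (y • b) = s • ((y • b) * (x • a)) := by
  rw [smul_mul_smul_comm, smul_mul_smul_comm, h, smul_comm, mul_comm]

theorem OddSphere.isTwisted (hd : Grades B d θ) :
    IsTwisted B (Presented.gen (OddRel θ)) (OddGen.deg d) where
  comm := OddSphere.gen_mul_gen hd
  adjoin_eq_top := Presented.adjoin_range_gen
  exists_torus g := by
    refine ⟨OddSphere.lift hd
      (fun a => phase (-B g (OddGen.deg d a)) • Presented.gen (OddRel θ) a)
      (fun a b => smul_mul_smul_comm_of_phase _ _ (OddSphere.gen_mul_gen hd a b)) ?_,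
      OddSphere.lift_gen hd _ _ _⟩
    simpa only [smul_mul_smul_comm, OddGen.deg, map_neg, map_zero,
      neg_neg, neg_zero, phase_zero, phase_neg_mul_phase, mul_one, one_smul] using
      OddSphere.sum_gen θ

theorem EvenSphere.isTwisted (hd : Grades B d θ) :
    IsTwisted B (Presented.gen (EvenRel θ)) (EvenGen.deg d) where
  comm := EvenSphere.gen_mul_gen hd
  adjoin_eq_top := Presented.adjoin_range_gen
  exists_torus g := by
    refine ⟨EvenSphere.lift hd
      (fun a => phase (-B g (EvenGen.deg d a)) • Presented.gen (EvenRel θ) a)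
      (fun a b => smul_mul_smul_comm_of_phase _ _ (EvenSphere.gen_mul_gen hd a b)) ?_,
      EvenSphere.lift_gen hd _ _ _⟩
    simpa only [smul_mul_smul_comm, EvenGen.deg, map_neg, map_zero,
      neg_neg, neg_zero, phase_zero, phase_neg_mul_phase, mul_one, one_smul] using
      EvenSphere.sum_gen θ

/-! ### Weyl representations of the odd spheres -/

/-- The points of the classical unit sphere of complex `n`-space. -/
abbrev Sphere (n : ℕ) : Type := {p : Fin n → ℂ // ∑ i, p i * star (p i) = 1}

/-- The Weyl representation of an odd sphere attached to a point `p` of the classical sphere: the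
generator `z i` acts as `p i` times the Weyl operator of degree `d i`. -/
noncomputable def weylRep (hB : B.IsAlt) (hd : Grades B d θ) (p : Sphere n) :
    OddSphere θ →ₐ[ℂ] Module.End ℂ (G → ℂ) :=
  OddSphere.lift hd (fun a => OddGen.val p.1 a • weyl B (OddGen.deg d a))
    (fun a b => smul_mul_smul_comm_of_phase _ _ (weyl_mul_comm B hB _ _)) (by
      simp only [smul_mul_smul_comm, OddGen.deg, weyl_mul_neg B hB, OddGen.val, ← Finset.sum_smul,
        p.2, one_smul])

theorem weylRep_gen (hB : B.IsAlt) (hd : Grades B d θ) (p : Sphere n) (a : OddGen n) :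
    weylRep hB hd p (Presented.gen _ a) = OddGen.val p.1 a • weyl B (OddGen.deg d a) :=
  OddSphere.lift_gen _ _ _ _ _

theorem weylRep_z (hB : B.IsAlt) (hd : Grades B d θ) (p : Sphere n) (i : Fin n) :
    weylRep hB hd p (z θ i) = p.1 i • weyl B (d i) :=
  weylRep_gen hB hd p (.z i)

theorem weylRep_star_z (hB : B.IsAlt) (hd : Grades B d θ) (p : Sphere n) (i : Fin n) :
    weylRep hB hd p (star (z θ i)) = star (p.1 i) • weyl B (-d i) := by
  rw [star_z]
  exact weylRep_gen hB hd p (.zbar i)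

/-- The Weyl representations attached to the points of the classical sphere are jointly faithful,
even when only the value at `0` of the image of the constant function is retained. -/
theorem eq_zero_of_weylRep (hB : B.IsAlt) (hd : Grades B d θ) (a : OddSphere θ)
    (ha : ∀ p, weylRep hB hd p a 1 0 = 0) : a = 0 := by
  refine (OddSphere.isTwisted hd).eq_zero_of_symbol (u := OddGen.z) hB
    (fun a => by cases a <;> simp [star, OddGen.deg]) (OddSphere.sum_gen θ) a fun c hc hc1 => ?_
  have hc' (i : Fin n) : c (.zbar i) = star (c (.z i)) := hc (.z i)
  refine ⟨weylRep hB hd ⟨fun i => c (.z i), ?_⟩, fun a => ?_, ha _⟩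
  · rw [← hc1]
    exact Finset.sum_congr rfl fun i _ => congrArg _ (hc' i).symm
  · rw [weylRep_gen]
    congr 1
    cases a
    · rfl
    · exact (hc' _).symm

theorem eq_of_weylRep (hB : B.IsAlt) (hd : Grades B d θ) {a b : OddSphere θ}
    (h : ∀ p, weylRep hB hd p a = weylRep hB hd p b) : a = b :=
  sub_eq_zero.mp <| eq_zero_of_weylRep hB hd _ fun p => by simp [h]

end spheres

/-! ### Gradings adapted to an antisymmetric matrix -/

/-- Half of the alternating form with matrix `θ`. -/
noncomputable def skewForm {n : ℕ} (θ : Skew n) : (Fin n → ℝ) →ₗ[ℝ] (Fin n → ℝ) →ₗ[ℝ] ℝ :=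
  Matrix.toLinearMap₂' ℝ ((1 / 2 : ℝ) • θ.1)

theorem skewForm_isAlt {n : ℕ} (θ : Skew n) : (skewForm θ).IsAlt := fun v => by
  have h : v ⬝ᵥ θ.1.mulVec v = -(v ⬝ᵥ θ.1.mulVec v) := by
    conv_lhs => rw [Matrix.dotProduct_mulVec, ← Matrix.mulVec_transpose, θ.2, dotProduct_comm,
      Matrix.neg_mulVec, dotProduct_neg]
  rw [skewForm, Matrix.toLinearMap₂'_apply', Matrix.smul_mulVec, dotProduct_smul,
    self_eq_neg.mp h, smul_zero]

theorem skewForm_single {n : ℕ} (θ : Skew n) (i j : Fin n) :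
    skewForm θ (Pi.single i 1) (Pi.single j 1) = 1 / 2 * θ.1 i j := by
  rw [skewForm, Matrix.toLinearMap₂'_apply', Matrix.mulVec_single_one, single_one_dotProduct]
  rfl

theorem grades_single {n : ℕ} (θ : Skew n) :
    Grades (skewForm θ) (fun i => Pi.single i 1) θ := fun i j => by
  rw [skewForm_single, Skew.lam]
  congr 1
  ring

/-- The generators of an odd sphere are linearly independent. -/
theorem coeff_eq_of_sum_smul_z {n : ℕ} {θ : Skew n} {c c' : Fin n → ℂ}
    (h : ∑ i, c i • z θ i = ∑ i, c' i • z θ i) : c = c' := by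
  ext k
  have := congrArg (weylRep (skewForm_isAlt θ) (grades_single θ)
    ⟨Pi.single k 1, by simp [Pi.single_apply]⟩) h
  simp only [map_sum, map_smul, weylRep_z, Pi.single_apply, ite_smul, one_smul, zero_smul,
    smul_ite, smul_zero, Finset.sum_ite_eq', Finset.mem_univ, if_true] at this
  exact smul_left_injective ℂ (weyl_ne_zero _ _) this

/-! ### The parameters that admit the action -/

/-- The condition on the deformation parameters: they only depend on the blocks. -/
def BlockParam (θ' : Skew 4) : Prop :=
  θ'.lam 0 1 = 1 ∧ θ'.lam 2 3 = 1 ∧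
    θ'.lam 0 3 = θ'.lam 1 2 ∧ θ'.lam 1 2 = θ'.lam 1 3 ∧ θ'.lam 1 3 = θ'.lam 0 2

theorem BlockParam.lam_eq {θ' : Skew 4} (h : BlockParam θ') (i j : Fin 4) :
    θ'.lam i j = lamMatrix (θ'.lam 0 2) i j := by
  obtain ⟨h01, h23, h1, h2, h3⟩ := h
  have h10 : θ'.lam 1 0 = 1 := by rw [← θ'.star_lam 0 1, h01, star_one]
  have h32 : θ'.lam 3 2 = 1 := by rw [← θ'.star_lam 2 3, h23, star_one]
  have h20 := θ'.star_lam 0 2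
  have h30 := θ'.star_lam 0 3
  have h21 := θ'.star_lam 1 2
  have h31 := θ'.star_lam 1 3
  rw [h1, h2, h3] at h30
  rw [h2, h3] at h21
  rw [h3] at h31
  fin_cases i <;> fin_cases j <;> simp_all [lamMatrix, Skew.lam_self]

theorem lam_eq_lam_of_smul_weyl {n : ℕ} (θ : Skew n) {a b : Fin n} {c c' l : ℂ} (hc : c ≠ 0)
    (hc' : c' = c)
    (h : c • (weyl (skewForm θ) (Pi.single a 1) * weyl (skewForm θ) (Pi.single b 1)) =
      (l * c') • (weyl (skewForm θ) (Pi.single b 1) * weyl (skewForm θ) (Pi.single a 1))) :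
    l = θ.lam a b := by
  subst hc'
  rw [weyl_mul_comm _ (skewForm_isAlt θ) (Pi.single a 1), grades_single, smul_smul, weyl_mul,
    smul_smul, smul_smul] at h
  have h' := smul_left_injective ℂ (weyl_ne_zero (skewForm θ) _) h
  have := mul_right_cancel₀ (phase_ne_zero _) h'
  rw [mul_comm l] at this
  exact (mul_left_cancel₀ hc this).symm

theorem blockParam_of_actsAs {θ' : Skew 4}
    (h : ∀ w : SU2, ∃ f : OddSphere θ' ≃⋆ₐ[ℂ] OddSphere θ', ActsAs w f) : BlockParam θ' := by
  -- a matrix of `SU(2)` without zero entries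
  obtain ⟨f, hf⟩ := h ⟨!![3 / 5, 4 / 5; -4 / 5, 3 / 5], by
    rw [Matrix.mem_specialUnitaryGroup_iff, Matrix.mem_unitaryGroup_iff]
    constructor
    · ext i j
      fin_cases i <;> fin_cases j <;>
        simp [Matrix.mul_apply, Fin.sum_univ_two, Complex.conj_ofNat, Matrix.star_apply] <;>
          norm_num
    · simp [Matrix.det_fin_two]; norm_num⟩
  have key (p : Sphere 4) (i j : Fin 4) := congrArg
    (fun a => weylRep (skewForm_isAlt θ') (grades_single θ') p (f a))
    (Presented.mk_rel _ (OddRel.zz (θ := θ') i j))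
  have hz (i : Fin 4) : Presented.mk (OddRel θ') (FreeStar.of (.z i)) = z θ' i := rfl
  simp only [map_mul, map_smul, hz, hf _, Fin.sum_univ_four, weylRep_z, doubled,
    map_add] at key
  -- at a point with few nonzero coordinates, only one product of generators survives
  have s1 : ∑ i, ![1, 0, 0, 0] i * star ((![1, 0, 0, 0] : Fin 4 → ℂ) i) = 1 := by
    simp [Fin.sum_univ_four]
  have s2 : ∑ i, ![0, 0, 1, 0] i * star ((![0, 0, 1, 0] : Fin 4 → ℂ) i) = 1 := by
    simp [Fin.sum_univ_four]
  have s3 : ∑ i, ![3 / 5, 0, 0, 4 / 5] i * star ((![3 / 5, 0, 0, 4 / 5] : Fin 4 → ℂ) i) = 1 := by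
    simp [Fin.sum_univ_four, Complex.conj_ofNat]
    norm_num
  have s4 : ∑ i, ![0, 3 / 5, 4 / 5, 0] i * star ((![0, 3 / 5, 4 / 5, 0] : Fin 4 → ℂ) i) = 1 := by
    simp [Fin.sum_univ_four, Complex.conj_ofNat]
    norm_num
  have s5 : ∑ i, ![0, 3 / 5, 0, 4 / 5] i * star ((![0, 3 / 5, 0, 4 / 5] : Fin 4 → ℂ) i) = 1 := by
    simp [Fin.sum_univ_four, Complex.conj_ofNat]
    norm_num
  have k1 := key ⟨![1, 0, 0, 0], s1⟩ 0 1
  have k2 := key ⟨![0, 0, 1, 0], s2⟩ 2 3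
  have k3 := key ⟨![3 / 5, 0, 0, 4 / 5], s3⟩ 0 2
  have k4 := key ⟨![0, 3 / 5, 4 / 5, 0], s4⟩ 0 2
  have k5 := key ⟨![0, 3 / 5, 0, 4 / 5], s5⟩ 0 2
  simp [smul_smul] at k1 k2 k3 k4 k5
  have e1 := lam_eq_lam_of_smul_weyl θ' (by norm_num) (by norm_num) k1
  have e2 := lam_eq_lam_of_smul_weyl θ' (by norm_num) (by norm_num) k2
  have e3 := lam_eq_lam_of_smul_weyl θ' (by norm_num) (by norm_num) k3
  have e4 := lam_eq_lam_of_smul_weyl θ' (by norm_num) (by norm_num) k4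
  have e5 := lam_eq_lam_of_smul_weyl θ' (by norm_num) (by norm_num) k5
  rw [Skew.lam_self] at e1 e2
  exact ⟨e1, e2, e3.symm.trans e4, e4.symm.trans e5, e5.symm⟩

/-- The degrees in the grading by the two blocks. -/
def blockDeg : Fin 4 → Fin 2 → ℝ :=
  ![Pi.single 0 1, Pi.single 0 1, Pi.single 1 1, Pi.single 1 1]

theorem skewForm_skew2 (t : ℝ) (i j : Fin 2) :
    skewForm (skew2 t) (Pi.single i 1) (Pi.single j 1) = 1 / 2 * !![0, t; -t, 0] i j :=
  skewForm_single (skew2 t) i j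

theorem BlockParam.grades {θ' : Skew 4} (h : BlockParam θ') :
    Grades (skewForm (skew2 (θ'.1 0 2))) blockDeg θ' := fun i j => by
  rw [h.lam_eq, Skew.lam]
  fin_cases i <;> fin_cases j <;>
    simp [blockDeg, lamMatrix, skewForm_skew2, star_phase]

/-! ### The action of `SU(2)` -/

theorem map_star_of_generators {A ι R : Type} [Ring A] [StarRing A] [Algebra ℂ A] [StarModule ℂ A]
    [Ring R] [StarRing R] [Algebra ℂ R] [StarModule ℂ R] {t : ι → A}
    (ht : Algebra.adjoin ℂ (Set.range t) = ⊤) (f : A →ₐ[ℂ] R)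
    (hf : ∀ i, f (star (t i)) = star (f (t i))) (a : A) : f (star a) = star (f a) := by
  have ha : a ∈ Algebra.adjoin ℂ (Set.range t) := ht ▸ trivial
  induction ha using Algebra.adjoin_induction with
  | mem x hx => obtain ⟨i, rfl⟩ := hx; exact hf i
  | algebraMap r => simp [Algebra.algebraMap_eq_smul_one, star_smul]
  | add x y _ _ hx hy => simp [hx, hy]
  | mul x y _ _ hx hy => simp [hx, hy]

theorem OddSphere.starHom_ext {n : ℕ} {θ : Skew n} {R : Type} [Ring R] [StarRing R] [Algebra ℂ R]
    {f g : OddSphere θ →⋆ₐ[ℂ] R} (h : ∀ i, f (z θ i) = g (z θ i)) : f = g := by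
  suffices hfg : (f : OddSphere θ →ₐ[ℂ] R) = g from
    StarAlgHom.ext fun x => DFunLike.congr_fun hfg x
  refine Presented.hom_ext ?_
  rintro (i | i)
  · exact h i
  · have : Presented.gen (OddRel θ) (.zbar i) = star (z θ i) := (star_z θ i).symm
    simp only [this, StarAlgHom.coe_toAlgHom, map_star, h]

/-- The space of linear combinations of the generators of degree `g`. -/
def linSpan {n : ℕ} {G : Type} [AddCommGroup G] (θ : Skew n) (d : Fin n → G) (g : G) :
    Submodule ℂ (OddSphere θ) :=
  Submodule.span ℂ {x | ∃ a, OddGen.deg d a = g ∧ Presented.gen (OddRel θ) a = x}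

theorem linSpan_mul_comm {n : ℕ} {G : Type} [AddCommGroup G] [Module ℝ G]
    {B : G →ₗ[ℝ] G →ₗ[ℝ] ℝ} {θ : Skew n} {d : Fin n → G} (hd : Grades B d θ) {g h : G}
    {x y : OddSphere θ} (hx : x ∈ linSpan θ d g) (hy : y ∈ linSpan θ d h) :
    x * y = phase (2 * B g h) • (y * x) := by
  induction hx, hy using Submodule.span_induction₂ with
  | mem_mem x y hx hy =>
    obtain ⟨a, rfl, rfl⟩ := hx
    obtain ⟨b, rfl, rfl⟩ := hy
    exact OddSphere.gen_mul_gen hd a b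
  | zero_left => simp
  | zero_right => simp
  | add_left x y z _ _ _ h1 h2 => rw [add_mul, mul_add, h1, h2, smul_add]
  | add_right x y z _ _ _ h1 h2 => rw [add_mul, mul_add, h1, h2, smul_add]
  | smul_left r x y _ _ h => rw [smul_mul_assoc, h, mul_smul_comm, smul_comm]
  | smul_right r x y _ _ h => rw [smul_mul_assoc, mul_smul_comm, h, smul_comm]

theorem doubled_mul (v w : Matrix (Fin 2) (Fin 2) ℂ) :
    doubled (v * w) = doubled v * doubled w := by
  ext i j
  fin_cases i <;> fin_cases j <;> simp [doubled, Matrix.mul_apply, Fin.sum_univ_succ]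

theorem doubled_one : doubled 1 = 1 := by
  ext i j
  fin_cases i <;> fin_cases j <;> simp [doubled]

theorem doubled_star (w : Matrix (Fin 2) (Fin 2) ℂ) : doubled (star w) = star (doubled w) := by
  ext i j
  fin_cases i <;> fin_cases j <;> simp [doubled, Matrix.star_apply]

theorem doubled_mul_star (w : SU2) (i k : Fin 4) :
    ∑ j, doubled w.1 i j * star (doubled w.1 k j) = (1 : Matrix (Fin 4) (Fin 4) ℂ) i k := by
  have h := Matrix.mem_unitaryGroup_iff.mp (Matrix.mem_specialUnitaryGroup_iff.mp w.2).1
  rw [← doubled_one, ← h, doubled_mul, doubled_star, Matrix.mul_apply]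
  rfl

theorem blockDeg_eq_of_doubled_ne_zero (w : SU2) {i j : Fin 4} (h : doubled w.1 i j ≠ 0) :
    blockDeg i = blockDeg j := by
  fin_cases i <;> fin_cases j <;> simp_all [doubled, blockDeg]

/-- The linear combination `∑ i, w i j z i` prescribed for the image of `z j`. -/
def rotZ (θ' : Skew 4) (w : SU2) (j : Fin 4) : OddSphere θ' := ∑ i, doubled w.1 i j • z θ' i

/-- The images of all generators under the prescription. -/
def rotGen (θ' : Skew 4) (w : SU2) : OddGen 4 → OddSphere θ'
  | .z j => rotZ θ' w j
  | .zbar j => star (rotZ θ' w j)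

theorem rotGen_mem (θ' : Skew 4) (w : SU2) (a : OddGen 4) :
    rotGen θ' w a ∈ linSpan θ' blockDeg (OddGen.deg blockDeg a) := by
  have aux (c : ℂ) (i j : Fin 4) (hc : c ≠ 0 → doubled w.1 i j ≠ 0) :
      c • z θ' i ∈ linSpan θ' blockDeg (blockDeg j) ∧
        c • star (z θ' i) ∈ linSpan θ' blockDeg (-blockDeg j) := by
    by_cases h : c = 0
    · simp [h]
    have h' := blockDeg_eq_of_doubled_ne_zero w (hc h)
    exact ⟨Submodule.smul_mem _ _ (Submodule.subset_span ⟨.z i, h', rfl⟩),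
      Submodule.smul_mem _ _ (Submodule.subset_span
        ⟨.zbar i, congrArg Neg.neg h', (star_z θ' i).symm⟩)⟩
  rcases a with j | j
  · simp only [rotGen, rotZ]
    exact sum_mem fun i _ => (aux _ i j id).1
  · simp only [rotGen, rotZ, star_sum, star_smul]
    exact sum_mem fun i _ => (aux _ i j (by simp)).2

theorem sum_rotZ (θ' : Skew 4) (w : SU2) : ∑ j, rotZ θ' w j * star (rotZ θ' w j) = 1 := by
  have h : ∑ i, z θ' i * star (z θ' i) = 1 := by
    simp only [star_z]
    exact OddSphere.sum_gen θ'
  calc ∑ j, rotZ θ' w j * star (rotZ θ' w j)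
      = ∑ i, ∑ k, (∑ j, doubled w.1 i j * star (doubled w.1 k j)) • (z θ' i * star (z θ' k)) := by
        simp only [rotZ, star_sum, star_smul, Finset.sum_mul_sum, smul_mul_smul_comm,
          Finset.sum_smul]
        rw [Finset.sum_comm]
        exact Finset.sum_congr rfl fun i _ => Finset.sum_comm
    _ = 1 := by simp only [doubled_mul_star, Matrix.one_apply]; simp [h]

/-- The algebra endomorphism attached to a matrix of `SU(2)`. -/
noncomputable def rotAlgHom {θ' : Skew 4} (h : BlockParam θ') (w : SU2) :
    OddSphere θ' →ₐ[ℂ] OddSphere θ' :=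
  OddSphere.lift h.grades (rotGen θ' w)
    (fun a b => linSpan_mul_comm h.grades (rotGen_mem θ' w a) (rotGen_mem θ' w b))
    (sum_rotZ θ' w)

theorem rotAlgHom_gen {θ' : Skew 4} (h : BlockParam θ') (w : SU2) (a : OddGen 4) :
    rotAlgHom h w (Presented.gen _ a) = rotGen θ' w a :=
  OddSphere.lift_gen _ _ _ _ _

/-- The `*`-endomorphism attached to a matrix of `SU(2)`. -/
noncomputable def rotHom {θ' : Skew 4} (h : BlockParam θ') (w : SU2) :
    OddSphere θ' →⋆ₐ[ℂ] OddSphere θ' :=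
  { rotAlgHom h w with
    map_star' := map_star_of_generators Presented.adjoin_range_gen (rotAlgHom h w) (by
      have h1 (i : Fin 4) : star (Presented.gen (OddRel θ') (.z i)) =
        Presented.gen (OddRel θ') (.zbar i) := star_z θ' i
      rintro (i | i)
      · rw [h1, rotAlgHom_gen, rotAlgHom_gen]
        rfl
      · rw [← h1, star_star, h1, rotAlgHom_gen, rotAlgHom_gen]
        exact (star_star _).symm) }

theorem rotHom_z {θ' : Skew 4} (h : BlockParam θ') (w : SU2) (j : Fin 4) :
    rotHom h w (z θ' j) = ∑ i, doubled w.1 i j • z θ' i :=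
  rotAlgHom_gen h w (.z j)

theorem rotHom_mul {θ' : Skew 4} (h : BlockParam θ') (v w : SU2) :
    rotHom h (v * w) = (rotHom h v).comp (rotHom h w) := by
  refine OddSphere.starHom_ext fun j => ?_
  have hvw : (v * w).1 = v.1 * w.1 := rfl
  simp only [StarAlgHom.comp_apply, rotHom_z, map_sum, map_smul, hvw, doubled_mul,
    Matrix.mul_apply, Finset.sum_smul, Finset.smul_sum, smul_smul]
  rw [Finset.sum_comm]
  simp only [mul_comm]

theorem rotHom_one {θ' : Skew 4} (h : BlockParam θ') : rotHom h 1 = StarAlgHom.id ℂ _ := by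
  refine OddSphere.starHom_ext fun j => ?_
  simp [rotHom_z, doubled_one, Matrix.one_apply]

theorem exists_hopfAction {θ' : Skew 4} (h : BlockParam θ') :
    ∃ a : SU2 →* (OddSphere θ' ≃⋆ₐ[ℂ] OddSphere θ'), IsHopfAction a := by
  refine ⟨{ toFun w := StarAlgEquiv.ofStarAlgHom (rotHom h w) (rotHom h w⁻¹) ?_ ?_
            map_one' := ?_
            map_mul' := fun v w => ?_ }, fun w j => rotHom_z h w j⟩
  · rw [← rotHom_mul, inv_mul_cancel, rotHom_one]
  · rw [← rotHom_mul, mul_inv_cancel, rotHom_one]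
  · exact StarAlgEquiv.ext fun x => DFunLike.congr_fun (rotHom_one h) x
  · exact StarAlgEquiv.ext fun x => DFunLike.congr_fun (rotHom_mul h v w) x

theorem IsHopfAction.injective {θ' : Skew 4} {a : SU2 →* (OddSphere θ' ≃⋆ₐ[ℂ] OddSphere θ')}
    (ha : IsHopfAction a) : Function.Injective a := fun v w hvw => by
  have key (j : Fin 4) : (fun i => doubled v.1 i j) = fun i => doubled w.1 i j :=
    coeff_eq_of_sum_smul_z (by rw [← ha v j, ← ha w j, hvw])
  have h0 := congrFun (key 0)
  have h1 := congrFun (key 1)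
  ext i j
  fin_cases i <;> fin_cases j
  exacts [h0 0, h1 0, h0 1, h1 1]

theorem tfae_hopfAction (θ' : Skew 4) :
    List.TFAE
      [∀ w : SU2, ∃ f : OddSphere θ' ≃⋆ₐ[ℂ] OddSphere θ', ActsAs w f,
       ∃ a : SU2 →* (OddSphere θ' ≃⋆ₐ[ℂ] OddSphere θ'), IsHopfAction a ∧ Function.Injective a,
       BlockParam θ'] := by
  tfae_have 1 → 3 := blockParam_of_actsAs
  tfae_have 3 → 2 := fun h => by
    obtain ⟨a, ha⟩ := exists_hopfAction h
    exact ⟨a, ha, ha.injective⟩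
  tfae_have 2 → 1 := fun ⟨a, ha, _⟩ w => ⟨a w, ha w⟩
  tfae_finish

theorem IsHopfAction.blockParam {θ' : Skew 4} {a : SU2 →* (OddSphere θ' ≃⋆ₐ[ℂ] OddSphere θ')}
    (ha : IsHopfAction a) : BlockParam θ' :=
  blockParam_of_actsAs fun w => ⟨a w, ha w⟩

section hopf

open MvPolynomial

/-! ### Block-graded Weyl representations and the action -/

variable {θ' : Skew 4}

/-- The Weyl representation of the seven-sphere with the grading by the two blocks. -/
noncomputable def blockRep (h : BlockParam θ') (p : Sphere 4) :
    OddSphere θ' →ₐ[ℂ] Module.End ℂ ((Fin 2 → ℝ) → ℂ) :=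
  weylRep (skewForm_isAlt (skew2 (θ'.1 0 2))) h.grades p

theorem blockRep_z (h : BlockParam θ') (p : Sphere 4) (i : Fin 4) :
    blockRep h p (z θ' i) = p.1 i • weyl (skewForm (skew2 (θ'.1 0 2))) (blockDeg i) :=
  weylRep_z _ _ p i

theorem blockRep_star_z (h : BlockParam θ') (p : Sphere 4) (i : Fin 4) :
    blockRep h p (star (z θ' i)) =
      star (p.1 i) • weyl (skewForm (skew2 (θ'.1 0 2))) (-blockDeg i) :=
  weylRep_star_z _ _ p i

theorem eq_of_blockRep (h : BlockParam θ') {a b : OddSphere θ'}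
    (hab : ∀ p, blockRep h p a = blockRep h p b) : a = b :=
  eq_of_weylRep _ _ hab

/-- The classical action of `SU(2)` on the points of the seven-sphere. -/
def rot (w : SU2) (p : Sphere 4) : Sphere 4 :=
  ⟨fun j => ∑ i, doubled w.1 i j * p.1 i, by
    calc ∑ j, (∑ i, doubled w.1 i j * p.1 i) * star (∑ i, doubled w.1 i j * p.1 i)
        = ∑ i, ∑ k, (∑ j, doubled w.1 i j * star (doubled w.1 k j)) *
            (p.1 i * star (p.1 k)) := by
          simp only [star_sum, star_mul', Finset.sum_mul_sum]
          simp only [Finset.sum_mul]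
          rw [Finset.sum_comm]
          refine Finset.sum_congr rfl fun i _ => Finset.sum_comm.trans ?_
          exact Finset.sum_congr rfl fun k _ => Finset.sum_congr rfl fun j _ =>
            mul_mul_mul_comm _ _ _ _
      _ = 1 := by
        simp only [doubled_mul_star, Matrix.one_apply]
        simpa using p.2⟩

/-- In the representations, the action moves the points of the classical sphere. -/
theorem blockRep_act (h : BlockParam θ') {a : SU2 →* (OddSphere θ' ≃⋆ₐ[ℂ] OddSphere θ')}
    (ha : IsHopfAction a) (w : SU2) (p : Sphere 4) (x : OddSphere θ') :
    blockRep h p (a w x) = blockRep h (rot w p) x := by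
  have hdeg (i j : Fin 4) (c : ℂ) (hc : c ≠ 0 → doubled w.1 i j ≠ 0) (ε : ℝ) :
      c • weyl (skewForm (skew2 (θ'.1 0 2))) (ε • blockDeg i) =
        c • weyl (skewForm (skew2 (θ'.1 0 2))) (ε • blockDeg j) := by
    by_cases h0 : c = 0
    · simp [h0]
    · rw [blockDeg_eq_of_doubled_ne_zero w (hc h0)]
  suffices H : (blockRep h p).comp ((a w : OddSphere θ' →⋆ₐ[ℂ] OddSphere θ') :
      OddSphere θ' →ₐ[ℂ] OddSphere θ') = blockRep h (rot w p) from DFunLike.congr_fun H x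
  refine Presented.hom_ext ?_
  rintro (j | j)
  · change blockRep h p (a w (z θ' j)) = blockRep h (rot w p) (z θ' j)
    rw [ha w j, blockRep_z, map_sum, rot, Finset.sum_smul]
    refine Finset.sum_congr rfl fun i _ => ?_
    rw [map_smul, blockRep_z, smul_smul]
    simpa using hdeg i j (doubled w.1 i j * p.1 i) left_ne_zero_of_mul 1
  · have hz : Presented.gen (OddRel θ') (.zbar j) = star (z θ' j) := (star_z θ' j).symm
    rw [hz]
    change blockRep h p (a w (star (z θ' j))) = blockRep h (rot w p) (star (z θ' j))
    rw [map_star, ha w j, blockRep_star_z, star_sum, map_sum, rot, star_sum, Finset.sum_smul]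
    refine Finset.sum_congr rfl fun i _ => ?_
    rw [star_smul, map_smul, blockRep_star_z, smul_smul, star_mul']
    simpa using hdeg i j (star (doubled w.1 i j) * star (p.1 i))
      (fun hc => star_ne_zero.mp (left_ne_zero_of_mul hc)) (-1)

/-! ### The Hopf map -/

/-- The degrees of `α` and `β` in the grading by the two blocks. -/
def hopfDeg : Fin 2 → Fin 2 → ℝ :=
  ![Pi.single 0 1 + -Pi.single 1 1, Pi.single 0 1 + Pi.single 1 1]

/-- The elements `α`, `β`, their adjoints and `x` of the seven-sphere. -/
def hopfGen (θ' : Skew 4) : EvenGen 2 → OddSphere θ'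
  | .z i => ![hopfα θ', hopfβ θ'] i
  | .zbar i => star (![hopfα θ', hopfβ θ'] i)
  | .x => hopfx θ'

/-- The classical Hopf map from the seven-sphere to the four-sphere, up to a rotation of the
coordinates `α` and `β` by a phase `s`, which arises from the ordering of Weyl operators. -/
def hopfMap (s : ℂ) (p : Fin 4 → ℂ) : EvenGen 2 → ℂ
  | .z i => ![s * (2 * (p 0 * star (p 2) + p 1 * star (p 3))),
      star s * (2 * (-(p 0 * p 3) + p 1 * p 2))] i
  | .zbar i => star (![s * (2 * (p 0 * star (p 2) + p 1 * star (p 3))),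
      star s * (2 * (-(p 0 * p 3) + p 1 * p 2))] i)
  | .x => p 0 * star (p 0) + p 1 * star (p 1) - p 2 * star (p 2) - p 3 * star (p 3)

/-- The phase in the classical Hopf map. -/
noncomputable def hopfPhase (θ' : Skew 4) : ℂ := phase (-(θ'.1 0 2 / 2))

theorem hopfPhase_mul_star (θ' : Skew 4) : hopfPhase θ' * star (hopfPhase θ') = 1 := by
  rw [hopfPhase, star_phase, ← phase_add, add_neg_cancel, phase_zero]

theorem blockRep_hopfGen (h : BlockParam θ') (p : Sphere 4) (a : EvenGen 2) :
    blockRep h p (hopfGen θ' a) = hopfMap (hopfPhase θ') p.1 a •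
      weyl (skewForm (skew2 (θ'.1 0 2))) (EvenGen.deg hopfDeg a) := by
  have h1 : phase (-(2⁻¹ * θ'.1 0 2)) = hopfPhase θ' := by rw [hopfPhase, div_eq_inv_mul]
  have h2 : phase (2⁻¹ * θ'.1 0 2) = starRingEnd ℂ (hopfPhase θ') := by
    rw [← h1, ← Complex.star_def, star_phase, neg_neg]
  rcases a with i | i | _
  · fin_cases i
    · simp [hopfGen, hopfα, hopfMap, EvenGen.deg, hopfDeg, blockRep_z, blockRep_star_z,
        blockDeg, weyl_mul, skewForm_skew2, h1]
      module
    · simp [hopfGen, hopfβ, hopfMap, EvenGen.deg, hopfDeg, blockRep_z,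
        blockDeg, weyl_mul, skewForm_skew2, h2]
      module
  · fin_cases i
    · simp [hopfGen, hopfα, hopfMap, EvenGen.deg, hopfDeg, blockRep_z, blockRep_star_z,
        blockDeg, weyl_mul, skewForm_skew2, h2]
      module
    · simp [hopfGen, hopfβ, hopfMap, EvenGen.deg, hopfDeg, blockRep_star_z,
        blockDeg, weyl_mul, skewForm_skew2, h1]
      module
  · simp [hopfGen, hopfx, hopfMap, EvenGen.deg, blockRep_z, blockRep_star_z,
        blockDeg, weyl_mul, skewForm_skew2]
    module

theorem hopfMap_rot (s : ℂ) (w : SU2) (p : Sphere 4) :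
    hopfMap s (rot w p).1 = hopfMap s p.1 := by
  have hdet : w.1 0 0 * w.1 1 1 - w.1 0 1 * w.1 1 0 = 1 := by
    rw [← Matrix.det_fin_two]
    exact (Matrix.mem_specialUnitaryGroup_iff.mp w.2).2
  have h00 := doubled_mul_star w 0 0
  have h01 := doubled_mul_star w 0 1
  have h10 := doubled_mul_star w 1 0
  have h11 := doubled_mul_star w 1 1
  simp [Fin.sum_univ_four, doubled] at h00 h01 h10 h11
  have hα : (rot w p).1 0 * star ((rot w p).1 2) + (rot w p).1 1 * star ((rot w p).1 3) =
      p.1 0 * star (p.1 2) + p.1 1 * star (p.1 3) := by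
    simp [rot, Fin.sum_univ_four, doubled]
    linear_combination p.1 0 * starRingEnd ℂ (p.1 2) * h00 + p.1 0 * starRingEnd ℂ (p.1 3) * h01 +
      p.1 1 * starRingEnd ℂ (p.1 2) * h10 + p.1 1 * starRingEnd ℂ (p.1 3) * h11
  have hβ : -((rot w p).1 0 * (rot w p).1 3) + (rot w p).1 1 * (rot w p).1 2 =
      -(p.1 0 * p.1 3) + p.1 1 * p.1 2 := by
    simp [rot, Fin.sum_univ_four, doubled]
    linear_combination (-(p.1 0 * p.1 3) + p.1 1 * p.1 2) * hdet
  have hA : (rot w p).1 0 * star ((rot w p).1 0) + (rot w p).1 1 * star ((rot w p).1 1) =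
      p.1 0 * star (p.1 0) + p.1 1 * star (p.1 1) := by
    simp [rot, Fin.sum_univ_four, doubled]
    linear_combination p.1 0 * starRingEnd ℂ (p.1 0) * h00 + p.1 0 * starRingEnd ℂ (p.1 1) * h01 +
      p.1 1 * starRingEnd ℂ (p.1 0) * h10 + p.1 1 * starRingEnd ℂ (p.1 1) * h11
  have hB : (rot w p).1 2 * star ((rot w p).1 2) + (rot w p).1 3 * star ((rot w p).1 3) =
      p.1 2 * star (p.1 2) + p.1 3 * star (p.1 3) := by
    simp [rot, Fin.sum_univ_four, doubled]
    linear_combination p.1 2 * starRingEnd ℂ (p.1 2) * h00 + p.1 2 * starRingEnd ℂ (p.1 3) * h01 +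
      p.1 3 * starRingEnd ℂ (p.1 2) * h10 + p.1 3 * starRingEnd ℂ (p.1 3) * h11
  ext (i | i | _)
  · simp only [hopfMap, hα, hβ]
  · simp only [hopfMap, hα, hβ]
  · simp only [hopfMap]
    linear_combination hA - hB

/-! ### Invariant functions on the classical seven-sphere -/

/-- The block matrix of `SU(2)` that rotates the vector `(u, v)` to `(r, 0)`. -/
noncomputable def rotator (u v : ℂ) (r : ℝ) (hr : r ≠ 0)
    (h : u * star u + v * star v = (r : ℂ) ^ 2) : SU2 :=
  ⟨(r : ℂ)⁻¹ • !![star u, -v; star v, u], by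
    have hr' : (r : ℂ) ≠ 0 := by exact_mod_cast hr
    simp only [Complex.star_def] at h
    rw [Matrix.mem_specialUnitaryGroup_iff, Matrix.mem_unitaryGroup_iff]
    constructor
    · ext i j
      fin_cases i <;> fin_cases j <;>
        simp [Matrix.mul_apply, Fin.sum_univ_two, Matrix.star_apply] <;> field_simp
      · linear_combination h
      · ring
      · ring
      · linear_combination h
    · simp [Matrix.det_fin_two]
      field_simp
      linear_combination h⟩

/-- The point `(A, 0, ᾱ / 2, -β / 2)`, where `A = |p 0| ^ 2 + |p 1| ^ 2`. -/
def sliceA (p : Fin 4 → ℂ) : Fin 4 → ℂ :=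
  ![p 0 * star (p 0) + p 1 * star (p 1), 0, star (p 0) * p 2 + star (p 1) * p 3,
    p 0 * p 3 - p 1 * p 2]

/-- The point `(α / 2, β / 2, A, 0)`, where `A = |p 2| ^ 2 + |p 3| ^ 2`. -/
def sliceB (p : Fin 4 → ℂ) : Fin 4 → ℂ :=
  ![p 0 * star (p 2) + p 1 * star (p 3), p 1 * p 2 - p 0 * p 3,
    p 2 * star (p 2) + p 3 * star (p 3), 0]

theorem val_rot_rotator_sliceA (p : Sphere 4) (r : ℝ) (hr : r ≠ 0)
    (h : p.1 0 * star (p.1 0) + p.1 1 * star (p.1 1) = (r : ℂ) ^ 2) :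
    OddGen.val (rot (rotator _ _ r hr h) p).1 = (r : ℂ)⁻¹ • OddGen.val (sliceA p.1) := by
  have key (j : Fin 4) : (rot (rotator _ _ r hr h) p).1 j = (r : ℂ)⁻¹ * sliceA p.1 j := by
    fin_cases j <;> simp [rot, rotator, doubled, sliceA, Fin.sum_univ_four] <;> ring
  ext (j | j)
  · exact key j
  · simp [OddGen.val, key]

theorem val_rot_rotator_sliceB (p : Sphere 4) (r : ℝ) (hr : r ≠ 0)
    (h : p.1 2 * star (p.1 2) + p.1 3 * star (p.1 3) = (r : ℂ) ^ 2) :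
    OddGen.val (rot (rotator _ _ r hr h) p).1 = (r : ℂ)⁻¹ • OddGen.val (sliceB p.1) := by
  have key (j : Fin 4) : (rot (rotator _ _ r hr h) p).1 j = (r : ℂ)⁻¹ * sliceB p.1 j := by
    fin_cases j <;> simp [rot, rotator, doubled, sliceB, Fin.sum_univ_four] <;> ring
  ext (j | j)
  · exact key j
  · simp [OddGen.val, key]

/-- If an invariant polynomial function `F` on the sphere can be evaluated at a multiple `r⁻¹ • y p`
of `y p`, where `N = y p k` is the square of the norm `r` of a pair of coordinates, then
`N ^ (M + 1) * F` is a polynomial in the coordinates of `y p`. -/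
theorem exists_eval_slice {S : Type} {F : S → ℂ} (f : MvPolynomial (OddGen 4) ℂ)
    (y : S → Fin 4 → ℂ) (k : Fin 4) (u v : S → ℂ)
    (hy : ∀ p, y p k = u p * star (u p) + v p * star (v p))
    (hF : ∀ p (r : ℝ), r ≠ 0 → y p k = (r : ℂ) ^ 2 →
      F p = eval ((r : ℂ)⁻¹ • OddGen.val (y p)) f) :
    ∃ (M : ℕ) (E : MvPolynomial (OddGen 4) ℂ), ∀ p,
      y p k ^ (M + 1) * F p = eval (OddGen.val (y p)) E := by
  obtain ⟨M, E, O, -, h⟩ := exists_parity_homogenization (X (.z k)) f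
  refine ⟨M, X (.z k) * E, fun p => ?_⟩
  obtain ⟨r, hr⟩ : ∃ r : ℝ, y p k = (r : ℂ) ^ 2 := by
    refine ⟨√(Complex.normSq (u p) + Complex.normSq (v p)), ?_⟩
    rw [← Complex.ofReal_pow, Real.sq_sqrt (add_nonneg (Complex.normSq_nonneg _)
      (Complex.normSq_nonneg _)), hy]
    simp [Complex.mul_conj]
  have hval : eval (OddGen.val (y p)) (X (.z k)) = y p k := eval_X _
  by_cases hr0 : r = 0
  · simp [hval, hr, hr0]
  have hr0' : (r : ℂ) ≠ 0 := by exact_mod_cast hr0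
  -- the two signs of `r` cancel the odd part
  have h1 := h (OddGen.val (y p)) r hr0' (hval.trans hr)
  have h2 := h (OddGen.val (y p)) (-r : ℝ) (by simpa using hr0) (by simpa [hval] using hr)
  rw [← hF p r hr0 hr] at h1
  rw [← hF p (-r) (by simpa using hr0) (by simpa using hr)] at h2
  rw [Complex.ofReal_neg, (even_two_mul M).neg_pow] at h2
  rw [eval_mul, hval, hr]
  linear_combination (r : ℂ) ^ 2 / 2 * (h1 + h2)

theorem eval_mem {S ι : Type} (𝒮 : Subalgebra ℂ (S → ℂ)) (y : S → ι → ℂ)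
    (hy : ∀ i, (fun p => y p i) ∈ 𝒮) (f : MvPolynomial ι ℂ) : (fun p => eval (y p) f) ∈ 𝒮 := by
  induction f using MvPolynomial.induction_on with
  | C a => simp only [eval_C]; exact 𝒮.algebraMap_mem a
  | add f g hf hg => simp only [eval_add]; exact add_mem hf hg
  | mul_X f i hf => simp only [eval_mul, eval_X]; exact mul_mem hf (hy i)

/-- The algebra of functions on the seven-sphere generated by the coordinates of the Hopf map. -/
def hopfFunctions (s : ℂ) : Subalgebra ℂ (Sphere 4 → ℂ) :=
  Algebra.adjoin ℂ (Set.range fun a p => hopfMap s p.1 a)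

/-- Invariant polynomial functions on the seven-sphere are polynomials in the coordinates of the
Hopf map: this holds after multiplication by powers of `A = |p 0| ^ 2 + |p 1| ^ 2` and
`B = |p 2| ^ 2 + |p 3| ^ 2`, and these are coprime since `A + B = 1`. -/
theorem mem_hopfFunctions_of_invariant {s : ℂ} (hs : s * star s = 1)
    (f : MvPolynomial (OddGen 4) ℂ)
    (hf : ∀ (w : SU2) (p : Sphere 4),
      eval (OddGen.val (rot w p).1) f = eval (OddGen.val p.1) f) :
    (fun p : Sphere 4 => eval (OddGen.val p.1) f) ∈ hopfFunctions s := by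
  have hc (a : EvenGen 2) : (fun p : Sphere 4 => hopfMap s p.1 a) ∈ hopfFunctions s :=
    Algebra.subset_adjoin ⟨a, rfl⟩
  have hsphere (p : Sphere 4) : p.1 0 * star (p.1 0) + p.1 1 * star (p.1 1) +
      p.1 2 * star (p.1 2) + p.1 3 * star (p.1 3) = 1 := by
    simpa [Fin.sum_univ_four] using p.2
  have hA : (fun p : Sphere 4 => p.1 0 * star (p.1 0) + p.1 1 * star (p.1 1)) ∈
      hopfFunctions s := by
    convert! (hopfFunctions s).smul_mem (add_mem (one_mem _) (hc .x)) (1 / 2 : ℂ) using 1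
    ext p
    simp only [Pi.smul_apply, Pi.add_apply, Pi.one_apply, hopfMap, smul_eq_mul]
    linear_combination (1 / 2 : ℂ) * hsphere p
  have hB : (fun p : Sphere 4 => p.1 2 * star (p.1 2) + p.1 3 * star (p.1 3)) ∈
      hopfFunctions s := by
    convert! (hopfFunctions s).smul_mem (sub_mem (one_mem _) (hc .x)) (1 / 2 : ℂ) using 1
    ext p
    simp only [Pi.smul_apply, Pi.sub_apply, Pi.one_apply, hopfMap, smul_eq_mul]
    linear_combination (1 / 2 : ℂ) * hsphere p
  have hα : (fun p : Sphere 4 => p.1 0 * star (p.1 2) + p.1 1 * star (p.1 3)) ∈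
      hopfFunctions s := by
    convert! (hopfFunctions s).smul_mem (hc (.z 0)) (star s / 2) using 1
    ext p
    simp only [Pi.smul_apply, hopfMap, smul_eq_mul, Matrix.cons_val_zero]
    linear_combination (-(p.1 0 * star (p.1 2) + p.1 1 * star (p.1 3))) * hs
  have hα' : (fun p : Sphere 4 => star (p.1 0) * p.1 2 + star (p.1 1) * p.1 3) ∈
      hopfFunctions s := by
    convert! (hopfFunctions s).smul_mem (hc (.zbar 0)) (s / 2) using 1
    ext p
    simp only [Pi.smul_apply, hopfMap, smul_eq_mul, Matrix.cons_val_zero, star_mul', star_add,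
      star_star, star_ofNat]
    linear_combination (-(star (p.1 0) * p.1 2 + star (p.1 1) * p.1 3)) * hs
  have hβ : (fun p : Sphere 4 => p.1 1 * p.1 2 - p.1 0 * p.1 3) ∈ hopfFunctions s := by
    convert! (hopfFunctions s).smul_mem (hc (.z 1)) (s / 2) using 1
    ext p
    simp only [Pi.smul_apply, hopfMap, smul_eq_mul, Matrix.cons_val_one, Matrix.cons_val_fin_one]
    linear_combination (-(p.1 1 * p.1 2 - p.1 0 * p.1 3)) * hs
  have hβ' : (fun p : Sphere 4 => star (p.1 1) * star (p.1 2) - star (p.1 0) * star (p.1 3)) ∈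
      hopfFunctions s := by
    convert! (hopfFunctions s).smul_mem (hc (.zbar 1)) (star s / 2) using 1
    ext p
    simp only [Pi.smul_apply, hopfMap, smul_eq_mul, Matrix.cons_val_one,
      Matrix.cons_val_fin_one, star_mul', star_add, star_star, star_ofNat, star_neg]
    linear_combination (-(star (p.1 1) * star (p.1 2) - star (p.1 0) * star (p.1 3))) * hs
  obtain ⟨M, E, hE⟩ := exists_eval_slice (F := fun p : Sphere 4 => eval (OddGen.val p.1) f) f
    (fun p => sliceA p.1) 0 (fun p => p.1 0) (fun p => p.1 1) (fun p => rfl) (fun p r hr h => by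
      rw [← val_rot_rotator_sliceA p r hr h, hf])
  obtain ⟨N, E', hE'⟩ := exists_eval_slice (F := fun p : Sphere 4 => eval (OddGen.val p.1) f) f
    (fun p => sliceB p.1) 2 (fun p => p.1 2) (fun p => p.1 3) (fun p => rfl) (fun p r hr h => by
      rw [← val_rot_rotator_sliceB p r hr h, hf])
  have hEmem := eval_mem (hopfFunctions s) (fun p => OddGen.val (sliceA p.1)) (by
    rintro (i | i) <;> fin_cases i
    · exact hA
    · exact zero_mem _
    · exact hα'
    · convert! neg_mem hβ using 1
      ext p
      simp [OddGen.val, sliceA]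
    · convert! hA using 1
      ext p
      simp [OddGen.val, sliceA, mul_comm]
    · convert! zero_mem (hopfFunctions s) using 1
      ext p
      simp [OddGen.val, sliceA]
    · convert! hα using 1
      ext p
      simp [OddGen.val, sliceA]
    · convert! neg_mem hβ' using 1
      ext p
      simp [OddGen.val, sliceA]) E
  have hEmem' := eval_mem (hopfFunctions s) (fun p => OddGen.val (sliceB p.1)) (by
    rintro (i | i) <;> fin_cases i
    · exact hα
    · exact hβ
    · exact hB
    · exact zero_mem _
    · convert! hα' using 1
      ext p
      simp [OddGen.val, sliceB]
    · convert! hβ' using 1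
      ext p
      simp [OddGen.val, sliceB]
    · convert! hB using 1
      ext p
      simp [OddGen.val, sliceB, mul_comm]
    · convert! zero_mem (hopfFunctions s) using 1
      ext p
      simp [OddGen.val, sliceB]) E'
  have hcop : IsCoprime (⟨_, hA⟩ : hopfFunctions s) ⟨_, hB⟩ :=
    ⟨1, 1, Subtype.ext (funext fun p => by
      simpa [add_assoc] using hsphere p)⟩
  obtain ⟨P, R, hPR⟩ := hcop.pow (m := M + 1) (n := N + 1)
  convert! add_mem (mul_mem P.2 hEmem) (mul_mem R.2 hEmem') using 1
  ext p
  have h1 := congrFun (congrArg Subtype.val hPR) p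
  simp only [Subalgebra.coe_add, Subalgebra.coe_mul, Subalgebra.coe_pow, Pi.add_apply,
    Pi.mul_apply, Pi.pow_apply, Subalgebra.coe_one, Pi.one_apply] at h1
  have h2 := hE p
  have h3 := hE' p
  simp only [sliceA, sliceB, Matrix.cons_val] at h2 h3
  simp only [Pi.add_apply, Pi.mul_apply, sliceA, sliceB]
  rw [← h2, ← h3]
  linear_combination (-eval (OddGen.val p.1) f) * h1

/-! ### The invariant subalgebra -/

theorem hopfGen_mem_adjoin (a : EvenGen 2) :
    hopfGen θ' a ∈ StarAlgebra.adjoin ℂ {hopfα θ', hopfβ θ', hopfx θ'} := by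
  have h (y) (hy : y ∈ ({hopfα θ', hopfβ θ', hopfx θ'} : Set (OddSphere θ'))) :=
    StarAlgebra.mem_adjoin_of_mem ℂ hy
  have hα := h (hopfα θ') (by simp)
  have hβ := h (hopfβ θ') (by simp)
  rcases a with i | i | _
  · fin_cases i
    exacts [hα, hβ]
  · fin_cases i
    exacts [star_mem hα, star_mem hβ]
  · exact h (hopfx θ') (by simp)

theorem hopfGen_mem_inv {a : SU2 →* (OddSphere θ' ≃⋆ₐ[ℂ] OddSphere θ')} (ha : IsHopfAction a)
    (b : EvenGen 2) : hopfGen θ' b ∈ Inv a := fun w =>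
  eq_of_blockRep ha.blockParam fun p => by
    rw [blockRep_act ha.blockParam ha, blockRep_hopfGen, blockRep_hopfGen, hopfMap_rot]

/-- Polynomials in the Hopf coordinates are symbols of elements generated by `α`, `β` and `x`: this
holds for monomials because the symbol is multiplicative up to phases on homogeneous elements. -/
theorem exists_symbol_eq_of_mem_hopfFunctions (h : BlockParam θ') {F : Sphere 4 → ℂ}
    (hF : F ∈ hopfFunctions (hopfPhase θ')) :
    ∃ b ∈ StarAlgebra.adjoin ℂ {hopfα θ', hopfβ θ', hopfx θ'},
      ∀ p, blockRep h p b 1 0 = F p := by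
  have hmon (m : Sphere 4 → ℂ) (hm : m ∈ Submonoid.closure
      (Set.range fun a (p : Sphere 4) => hopfMap (hopfPhase θ') p.1 a)) :
      ∃ b ∈ StarAlgebra.adjoin ℂ {hopfα θ', hopfβ θ', hopfx θ'}, ∃ g,
        ∀ p, blockRep h p b = m p • weyl (skewForm (skew2 (θ'.1 0 2))) g := by
    induction hm using Submonoid.closure_induction with
    | mem m hm =>
      obtain ⟨a, rfl⟩ := hm
      exact ⟨_, hopfGen_mem_adjoin a, _, fun p => blockRep_hopfGen h p a⟩
    | one => exact ⟨1, one_mem _, 0, fun p => by simp [weyl_zero]⟩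
    | mul m m' _ _ ih ih' =>
      obtain ⟨b, hb, g, hbg⟩ := ih
      obtain ⟨b', hb', g', hbg'⟩ := ih'
      refine ⟨phase (-skewForm (skew2 (θ'.1 0 2)) g g') • (b * b'),
        SMulMemClass.smul_mem _ (mul_mem hb hb'), g + g', fun p => ?_⟩
      rw [map_smul, map_mul, hbg, hbg', smul_mul_smul_comm, weyl_mul, smul_smul, smul_smul,
        Pi.mul_apply]
      congr 1
      linear_combination m p * m' p * phase_neg_mul_phase (skewForm (skew2 (θ'.1 0 2)) g g')
  rw [hopfFunctions, ← Subalgebra.mem_toSubmodule, Algebra.adjoin_eq_span] at hF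
  induction hF using Submodule.span_induction with
  | mem m hm =>
    obtain ⟨b, hb, g, hbg⟩ := hmon m hm
    refine ⟨b, hb, fun p => ?_⟩
    rw [hbg, LinearMap.smul_apply, Pi.smul_apply, weyl_one_zero, smul_eq_mul, mul_one]
  | zero => exact ⟨0, zero_mem _, fun p => by simp⟩
  | add F F' _ _ ih ih' =>
    obtain ⟨b, hb, hbF⟩ := ih
    obtain ⟨b', hb', hbF'⟩ := ih'
    exact ⟨b + b', add_mem hb hb', fun p => by simp [hbF, hbF']⟩
  | smul c F _ ih =>
    obtain ⟨b, hb, hbF⟩ := ih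
    exact ⟨c • b, SMulMemClass.smul_mem _ hb, fun p => by simp [hbF]⟩

theorem inv_eq_adjoin {a : SU2 →* (OddSphere θ' ≃⋆ₐ[ℂ] OddSphere θ')} (ha : IsHopfAction a) :
    Inv a = StarAlgebra.adjoin ℂ {hopfα θ', hopfβ θ', hopfx θ'} := by
  have h := ha.blockParam
  refine le_antisymm (fun y hy => ?_) (StarAlgebra.adjoin_le ?_)
  · have hB := skewForm_isAlt (skew2 (θ'.1 0 2))
    obtain ⟨Q, hQ, -, hev⟩ := (OddSphere.isTwisted h.grades).exists_quantization hB
    obtain ⟨f, rfl⟩ := hQ y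
    have hsymb (p : Sphere 4) : blockRep h p (Q f) 1 0 = eval (OddGen.val p.1) f :=
      hev _ _ (weylRep_gen hB h.grades p) f
    obtain ⟨b, hb, hbf⟩ := exists_symbol_eq_of_mem_hopfFunctions h
      (mem_hopfFunctions_of_invariant (hopfPhase_mul_star θ') f fun w p => by
        rw [← hsymb, ← hsymb, ← blockRep_act h ha, hy w])
    have : Q f - b = 0 := eq_zero_of_weylRep hB h.grades _ fun p => by
      change blockRep h p (Q f - b) 1 0 = 0
      rw [map_sub, LinearMap.sub_apply, Pi.sub_apply, hsymb, hbf, sub_self]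
    rwa [sub_eq_zero.mp this]
  · rintro _ (rfl | rfl | rfl)
    exacts [hopfGen_mem_inv ha (.z 0), hopfGen_mem_inv ha (.z 1), hopfGen_mem_inv ha .x]

/-! ### The four-sphere -/

/-- The Hopf map is onto the four-sphere. -/
theorem exists_hopfMap_eq {s : ℂ} (hs : s * star s = 1) (c : EvenGen 2 → ℂ)
    (hc : ∀ i, c (star i) = star (c i))
    (hc1 : c (.z 0) * c (.zbar 0) + c (.z 1) * c (.zbar 1) + c .x * c .x = 1) :
    ∃ p : Sphere 4, hopfMap s p.1 = c := by
  have hz (i : Fin 2) : c (.zbar i) = star (c (.z i)) := hc (.z i)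
  obtain ⟨x, hx⟩ : ∃ x : ℝ, (x : ℂ) = c .x := Complex.conj_eq_iff_real.mp (hc .x).symm |>.imp
    fun _ h => h.symm
  have hreal : Complex.normSq (c (.z 0)) + Complex.normSq (c (.z 1)) + x * x = 1 := by
    have : ((Complex.normSq (c (.z 0)) + Complex.normSq (c (.z 1)) + x * x : ℝ) : ℂ) = 1 := by
      rw [← hc1, hz, hz, ← hx]
      simp [Complex.mul_conj]
    exact_mod_cast this
  have h0 := Complex.normSq_nonneg (c (.z 0))
  have h1 := Complex.normSq_nonneg (c (.z 1))
  have ext_of (p : Fin 4 → ℂ) (hp0 : hopfMap s p (.z 0) = c (.z 0))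
      (hp1 : hopfMap s p (.z 1) = c (.z 1)) (hpx : hopfMap s p .x = c .x) : hopfMap s p = c := by
    have hbar (i : Fin 2) (h : hopfMap s p (.z i) = c (.z i)) :
        hopfMap s p (.zbar i) = c (.zbar i) := by rw [hz, ← h]; rfl
    ext (i | i | _)
    · fin_cases i
      exacts [hp0, hp1]
    · fin_cases i
      exacts [hbar 0 hp0, hbar 1 hp1]
    · exact hpx
  by_cases hx1 : x = -1
  · -- the south pole
    have e0 : c (.z 0) = 0 := Complex.normSq_eq_zero.mp (by nlinarith)
    have e1 : c (.z 1) = 0 := Complex.normSq_eq_zero.mp (by nlinarith)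
    refine ⟨⟨![0, 0, 1, 0], by simp [Fin.sum_univ_four]⟩, ext_of _ ?_ ?_ ?_⟩
    · simp [hopfMap, e0]
    · simp [hopfMap, e1]
    · simp [hopfMap, ← hx, hx1]
  · have hpos : 0 < (1 + x) / 2 := by
      have : -1 ≤ x := by nlinarith
      have := lt_of_le_of_ne this (Ne.symm hx1)
      linarith
    obtain ⟨r, hr, hr2⟩ : ∃ r : ℝ, r ≠ 0 ∧ r ^ 2 = (1 + x) / 2 :=
      ⟨√((1 + x) / 2), (Real.sqrt_pos.mpr hpos).ne', Real.sq_sqrt hpos.le⟩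
    have hr' : (r : ℂ) ≠ 0 := by exact_mod_cast hr
    have hr2' : (r : ℂ) ^ 2 = (1 + c .x) / 2 := by rw [← hx]; exact_mod_cast hr2
    have hz0 := hz 0
    have hz1 := hz 1
    rw [hz0, hz1] at hc1
    simp only [Complex.star_def] at hc1 hs
    have hnorm : (starRingEnd ℂ (c (.z 0)) * s) / (2 * r) * (c (.z 0) * starRingEnd ℂ s / (2 * r)) +
        s * c (.z 1) / (2 * r) * (starRingEnd ℂ s * starRingEnd ℂ (c (.z 1)) / (2 * r)) =
          1 - (r : ℂ) ^ 2 := by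
      field_simp
      have h4 : 4 * (r : ℂ) ^ 2 * (1 - (r : ℂ) ^ 2) = 1 - c .x * c .x := by
        rw [hr2']; ring
      linear_combination (c (.z 0) * starRingEnd ℂ (c (.z 0)) +
        c (.z 1) * starRingEnd ℂ (c (.z 1))) * hs + hc1 - h4
    -- each fibre contains a point with `p 1 = 0` and `p 0 = r`, where `r ^ 2 = (1 + x) / 2`
    refine ⟨⟨![r, 0, star (c (.z 0)) * s / (2 * r), -(s * c (.z 1)) / (2 * r)], ?_⟩,
      ext_of _ ?_ ?_ ?_⟩
    · simp [Fin.sum_univ_four, Complex.conj_ofNat]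
      linear_combination hnorm
    · simp [hopfMap]
      field_simp
      linear_combination c (.z 0) * hs
    · simp [hopfMap]
      field_simp
      linear_combination c (.z 1) * hs
    · simp [hopfMap]
      linear_combination 2 * hr2' - hnorm

theorem skew2_lam (t : ℝ) (i j : Fin 2) : (skew2 t).lam i j = phase (!![0, t; -t, 0] i j) := rfl

theorem skewForm_hopfDeg (t : ℝ) (i j : Fin 2) :
    skewForm (skew2 t) (hopfDeg i) (hopfDeg j) = !![0, t; -t, 0] i j := by
  fin_cases i <;> fin_cases j <;> simp [hopfDeg, skewForm_skew2] <;> ring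

theorem phase_two_mul (t : ℝ) : phase (2 * t) = phase t ^ 2 := by rw [sq, ← phase_add, two_mul]

theorem grades_hopfDeg {θ : ℝ} (hθ : θ'.lam 0 2 ^ 2 = phase θ) :
    Grades (skewForm (skew2 (θ'.1 0 2))) hopfDeg (skew2 θ) := by
  have h2 : phase (2 * θ'.1 0 2) = phase θ := by rw [phase_two_mul, ← hθ, Skew.lam]
  have h3 : phase (-(2 * θ'.1 0 2)) = phase (-θ) := by rw [← star_phase, h2, star_phase]
  intro i j
  rw [skewForm_hopfDeg, skew2_lam]
  fin_cases i <;> fin_cases j <;> simp [h2, h3]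

/-- The homomorphism from the four-sphere to the seven-sphere. The relations hold since they hold in
the Weyl representations. -/
noncomputable def hopfAlgHom {θ : ℝ} (h : BlockParam θ') (hθ : θ'.lam 0 2 ^ 2 = phase θ) :
    FourSphere θ →ₐ[ℂ] OddSphere θ' :=
  EvenSphere.lift (grades_hopfDeg hθ) (hopfGen θ')
    (fun a b => eq_of_blockRep h fun p => by
      rw [map_smul, map_mul, map_mul, blockRep_hopfGen, blockRep_hopfGen]
      exact smul_mul_smul_comm_of_phase _ _ (weyl_mul_comm _ (skewForm_isAlt _) _ _))
    (eq_of_blockRep h fun p => by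
      have hp : p.1 0 * star (p.1 0) + p.1 1 * star (p.1 1) + p.1 2 * star (p.1 2) +
          p.1 3 * star (p.1 3) = 1 := by simpa [Fin.sum_univ_four] using p.2
      have hs := hopfPhase_mul_star θ'
      simp only [map_add, map_sum, map_mul, blockRep_hopfGen, smul_mul_smul_comm, EvenGen.deg,
        weyl_mul_neg _ (skewForm_isAlt _), weyl_zero, mul_one, ← Finset.sum_smul, ← add_smul,
        map_one]
      rw [← one_smul ℂ (1 : Module.End ℂ ((Fin 2 → ℝ) → ℂ)), smul_smul, mul_one]
      congr 1
      simp only [Fin.sum_univ_two, hopfMap, Matrix.cons_val_zero, Matrix.cons_val_one,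
        Matrix.cons_val_fin_one, star_mul', star_add, star_neg, star_star, star_ofNat]
      linear_combination 4 * ((p.1 0 * star (p.1 2) + p.1 1 * star (p.1 3)) *
        (star (p.1 0) * p.1 2 + star (p.1 1) * p.1 3) +
        (-(p.1 0 * p.1 3) + p.1 1 * p.1 2) *
        (-(star (p.1 0) * star (p.1 3)) + star (p.1 1) * star (p.1 2))) * hs +
        (p.1 0 * star (p.1 0) + p.1 1 * star (p.1 1) + p.1 2 * star (p.1 2) +
          p.1 3 * star (p.1 3) + 1) * hp)

theorem hopfAlgHom_gen {θ : ℝ} (h : BlockParam θ') (hθ : θ'.lam 0 2 ^ 2 = phase θ)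
    (a : EvenGen 2) : hopfAlgHom h hθ (Presented.gen _ a) = hopfGen θ' a :=
  EvenSphere.lift_gen _ _ _ _ _

theorem hopfAlgHom_injective {θ : ℝ} (h : BlockParam θ') (hθ : θ'.lam 0 2 ^ 2 = phase θ) :
    Function.Injective (hopfAlgHom h hθ) := by
  rw [injective_iff_map_eq_zero]
  intro y hy
  -- the summands of the sphere relation, those of `α` and `β` followed by that of `x`
  let u : Option (Fin 2) → EvenGen 2 := fun k => k.elim .x .z
  refine (EvenSphere.isTwisted (grades_hopfDeg hθ)).eq_zero_of_symbol (u := u)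
    (skewForm_isAlt _) (fun a => by cases a <;> simp [star, EvenGen.deg]) ?_ y fun c hc hc1 => ?_
  · rw [Fintype.sum_option, add_comm]
    exact EvenSphere.sum_gen (skew2 θ)
  · obtain ⟨p, hp⟩ := exists_hopfMap_eq (hopfPhase_mul_star θ') c hc (by
      rw [Fintype.sum_option, add_comm, Fin.sum_univ_two] at hc1
      exact hc1)
    refine ⟨(blockRep h p).comp (hopfAlgHom h hθ), fun a => ?_, ?_⟩
    · rw [AlgHom.comp_apply, hopfAlgHom_gen, blockRep_hopfGen, hp]
    · rw [AlgHom.comp_apply, hy, map_zero]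
      rfl

/-- The `*`-homomorphism from the four-sphere to the seven-sphere. -/
noncomputable def hopfHom {θ : ℝ} (h : BlockParam θ') (hθ : θ'.lam 0 2 ^ 2 = phase θ) :
    FourSphere θ →⋆ₐ[ℂ] OddSphere θ' :=
  { hopfAlgHom h hθ with
    map_star' := map_star_of_generators Presented.adjoin_range_gen (hopfAlgHom h hθ) (by
      have h1 (i : Fin 2) : star (Presented.gen (EvenRel (skew2 θ)) (.z i)) =
        Presented.gen (EvenRel (skew2 θ)) (.zbar i) := star_evenZ (skew2 θ) i
      have h2 : star (Presented.gen (EvenRel (skew2 θ)) .x) =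
        Presented.gen (EvenRel (skew2 θ)) .x := star_evenX (skew2 θ)
      rintro (i | i | _)
      · rw [h1, hopfAlgHom_gen, hopfAlgHom_gen]
        rfl
      · rw [← h1, star_star, h1, hopfAlgHom_gen, hopfAlgHom_gen]
        exact (star_star _).symm
      · rw [h2, hopfAlgHom_gen]
        simp [hopfGen, hopfx]) }

theorem adjoin_evenZ_evenX (θ : ℝ) :
    StarAlgebra.adjoin ℂ {evenZ (skew2 θ) 0, evenZ (skew2 θ) 1, evenX (skew2 θ)} = ⊤ := by
  rw [eq_top_iff]
  rintro y -
  have hy : y ∈ Algebra.adjoin ℂ (Set.range (Presented.gen (EvenRel (skew2 θ)))) :=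
    Presented.adjoin_range_gen ▸ trivial
  have h (i : Fin 2) : evenZ (skew2 θ) i ∈
      StarAlgebra.adjoin ℂ {evenZ (skew2 θ) 0, evenZ (skew2 θ) 1, evenX (skew2 θ)} :=
    StarAlgebra.mem_adjoin_of_mem ℂ (by fin_cases i <;> simp)
  refine Algebra.adjoin_le (S := (StarAlgebra.adjoin ℂ _).toSubalgebra) ?_ hy
  rintro _ ⟨i | i | _, rfl⟩
  · exact h i
  · have hz : Presented.gen (EvenRel (skew2 θ)) (.zbar i) = star (evenZ (skew2 θ) i) :=
      (star_evenZ (skew2 θ) i).symm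
    rw [hz]
    exact star_mem (S := StarSubalgebra ℂ (FourSphere θ)) (h i)
  · exact StarAlgebra.mem_adjoin_of_mem ℂ (Or.inr (Or.inr rfl))

theorem invIsFourSphere {θ : ℝ} {a : SU2 →* (OddSphere θ' ≃⋆ₐ[ℂ] OddSphere θ')}
    (ha : IsHopfAction a) (hθ : θ'.lam 0 2 ^ 2 = phase θ) : InvIsFourSphere θ a := by
  have h := ha.blockParam
  have h0 : hopfHom h hθ (evenZ _ 0) = hopfα θ' := hopfAlgHom_gen h hθ (.z 0)
  have h1 : hopfHom h hθ (evenZ _ 1) = hopfβ θ' := hopfAlgHom_gen h hθ (.z 1)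
  have hx : hopfHom h hθ (evenX _) = hopfx θ' := hopfAlgHom_gen h hθ .x
  refine ⟨hopfHom h hθ, h0, h1, hx, hopfAlgHom_injective h hθ, ?_⟩
  rw [inv_eq_adjoin ha, ← h0, ← h1, ← hx, StarAlgHom.range_eq_map_top, ← adjoin_evenZ_evenX,
    StarAlgHom.map_adjoin, Set.image_insert_eq, Set.image_pair]

/-- The relation between `α` and `β` determines the square of the deformation parameter. -/
theorem lam_sq_eq_phase {θ : ℝ} {a : SU2 →* (OddSphere θ' ≃⋆ₐ[ℂ] OddSphere θ')}
    (ha : IsHopfAction a) (hinv : InvIsFourSphere θ a) : θ'.lam 0 2 ^ 2 = phase θ := by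
  have h := ha.blockParam
  obtain ⟨φ, h0, h1, -⟩ := hinv
  -- a point of the sphere at which neither `α` nor `β` vanishes
  have hp : ∑ i, ![1 / 3, 0, 2 / 3, 2 / 3] i * star ((![1 / 3, 0, 2 / 3, 2 / 3] : Fin 4 → ℂ) i) =
      1 := by
    simp [Fin.sum_univ_four, Complex.conj_ofNat]
    norm_num
  let p : Sphere 4 := ⟨![1 / 3, 0, 2 / 3, 2 / 3], hp⟩
  have hrel : evenZ (skew2 θ) 0 * evenZ (skew2 θ) 1 =
      phase θ • (evenZ (skew2 θ) 1 * evenZ (skew2 θ) 0) := by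
    have := Presented.mk_rel _ (EvenRel.zz (θ := skew2 θ) 0 1)
    rw [map_smul, map_mul, map_mul] at this
    exact this
  have hs : hopfPhase θ' ≠ 0 := phase_ne_zero _
  have hα : hopfMap (hopfPhase θ') p.1 (.z 0) ≠ 0 := by
    simp [hopfMap, p, hs]
  have hβ : hopfMap (hopfPhase θ') p.1 (.z 1) ≠ 0 := by
    simp [hopfMap, p, hs]
  have key := congrArg (fun y => blockRep h p (φ y)) hrel
  have g0 : hopfα θ' = hopfGen θ' (.z 0) := rfl
  have g1 : hopfβ θ' = hopfGen θ' (.z 1) := rfl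
  simp only [map_mul, map_smul, h0, h1, g0, g1, blockRep_hopfGen, smul_mul_smul_comm] at key
  rw [weyl_mul_comm _ (skewForm_isAlt _) (EvenGen.deg hopfDeg (.z 0)), smul_smul, smul_smul,
    weyl_mul, smul_smul, smul_smul] at key
  have key' := mul_right_cancel₀ (phase_ne_zero _)
    (smul_left_injective ℂ (weyl_ne_zero _ _) key)
  simp only [EvenGen.deg, skewForm_hopfDeg] at key'
  rw [mul_comm (phase θ), mul_comm (hopfMap _ _ (.z 1))] at key'
  have := mul_left_cancel₀ (mul_ne_zero hα hβ) key'
  rw [← this, Skew.lam, ← phase_two_mul]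
  rfl

theorem phase_eq_phase_iff (s t : ℝ) : phase s = phase t ↔ ∃ m : ℤ, s = t + m := by
  have hc : 2 * (Real.pi : ℂ) * Complex.I ≠ 0 := Complex.two_pi_I_ne_zero
  rw [phase, phase, Complex.exp_eq_exp_iff_exists_int]
  refine exists_congr fun m => ?_
  rw [show 2 * (Real.pi : ℂ) * Complex.I * t + m * (2 * Real.pi * Complex.I) =
    2 * Real.pi * Complex.I * (t + m) by ring, mul_right_inj' hc]
  exact_mod_cast Iff.rfl

theorem lamMatrix_phase (t : ℝ) (i j : Fin 4) :
    lamMatrix (phase (t / 2)) i j = phase ((hopfSkew t).1 i j) := by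
  have h : (hopfSkew t).1 =
    (t / 2) • !![0, 0, 1, 1; 0, 0, 1, 1; -1, -1, 0, 0; -1, -1, 0, 0] := rfl
  rw [h]
  fin_cases i <;> fin_cases j <;> simp [lamMatrix, star_phase]

theorem tfae_invIsFourSphere (θ : ℝ) (θ' : Skew 4) :
    List.TFAE
      [∃ a : SU2 →* (OddSphere θ' ≃⋆ₐ[ℂ] OddSphere θ'), IsHopfAction a ∧ InvIsFourSphere θ a,
       ∃ μ : ℂ, μ ^ 2 = phase θ ∧ ∀ i j, θ'.lam i j = lamMatrix μ i j,
       ∃ k : ℤ, ∀ i j, ∃ m : ℤ, θ'.1 i j = (hopfSkew (θ + k)).1 i j + m] := by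
  tfae_have 1 → 2 := fun ⟨a, ha, hinv⟩ =>
    ⟨θ'.lam 0 2, lam_sq_eq_phase ha hinv, ha.blockParam.lam_eq⟩
  tfae_have 2 → 1 := by
    rintro ⟨μ, hμ, hlam⟩
    have h02 : θ'.lam 0 2 = μ := hlam 0 2
    have hblock : BlockParam θ' := by
      refine ⟨hlam 0 1, hlam 2 3, ?_, ?_, ?_⟩ <;> rw [hlam, hlam] <;> rfl
    obtain ⟨a, ha⟩ := exists_hopfAction hblock
    exact ⟨a, ha, invIsFourSphere ha (by rw [h02, hμ])⟩
  tfae_have 2 → 3 := by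
    rintro ⟨μ, hμ, hlam⟩
    have h02 : phase (θ'.1 0 2) = μ := hlam 0 2
    rw [← h02, ← phase_two_mul, phase_eq_phase_iff] at hμ
    obtain ⟨k, hk⟩ := hμ
    refine ⟨k, fun i j => (phase_eq_phase_iff _ _).mp ?_⟩
    rw [← lamMatrix_phase, ← hk, mul_div_cancel_left₀ _ two_ne_zero, h02]
    exact hlam i j
  tfae_have 3 → 2 := by
    rintro ⟨k, hk⟩
    refine ⟨phase ((θ + k) / 2), ?_, fun i j => ?_⟩
    · rw [← phase_two_mul, mul_div_cancel₀ _ two_ne_zero, phase_eq_phase_iff]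
      exact ⟨k, rfl⟩
    · rw [lamMatrix_phase, Skew.lam, phase_eq_phase_iff]
      exact hk i j
  tfae_finish

end hopf

end HopfTheta

open HopfTheta in
theorem mainTheorem5 :
    -- the prescription extends to automorphisms exactly for these parameters, and it is then
    -- a faithful action of the group
    (∀ θ' : Skew 4,
      List.TFAE
        [∀ w : SU2, ∃ f : OddSphere θ' ≃⋆ₐ[ℂ] OddSphere θ', ActsAs w f,
         ∃ a : SU2 →* (OddSphere θ' ≃⋆ₐ[ℂ] OddSphere θ'), IsHopfAction a ∧ Function.Injective a,
         θ'.lam 0 1 = 1 ∧ θ'.lam 2 3 = 1 ∧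
           θ'.lam 0 3 = θ'.lam 1 2 ∧ θ'.lam 1 2 = θ'.lam 1 3 ∧ θ'.lam 1 3 = θ'.lam 0 2]) ∧
    -- the invariant subalgebra is generated by `α`, `β`, `x`
    (∀ (θ' : Skew 4) (a : SU2 →* (OddSphere θ' ≃⋆ₐ[ℂ] OddSphere θ')), IsHopfAction a →
      Inv a = StarAlgebra.adjoin ℂ {hopfα θ', hopfβ θ', hopfx θ'}) ∧
    -- it is the four-sphere exactly for the parameter matrices with `μ = √λ`
    (∀ (θ : ℝ) (θ' : Skew 4),
      List.TFAE
        [∃ a : SU2 →* (OddSphere θ' ≃⋆ₐ[ℂ] OddSphere θ'), IsHopfAction a ∧ InvIsFourSphere θ a,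
         ∃ μ : ℂ, μ ^ 2 = phase θ ∧ ∀ i j, θ'.lam i j = lamMatrix μ i j,
         ∃ k : ℤ, ∀ i j, ∃ m : ℤ, θ'.1 i j = (hopfSkew (θ + k)).1 i j + m]) ∧
    -- in particular for `θ'` equal to `θ / 2` times the block matrix
    (∀ θ : ℝ, ∃ a : SU2 →* (OddSphere (hopfSkew θ) ≃⋆ₐ[ℂ] OddSphere (hopfSkew θ)),
      IsHopfAction a ∧ InvIsFourSphere θ a) := by
  refine ⟨tfae_hopfAction, fun θ' a ha => inv_eq_adjoin ha, tfae_invIsFourSphere, fun θ => ?_⟩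
  have h := (tfae_invIsFourSphere θ (hopfSkew θ)).out 0 2
  exact h.mpr ⟨0, fun i j => ⟨0, by simp⟩⟩
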